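/- Let $p,q$ be positive integers and let $(\bar M,\bar g,\bar J)$ be a finite-dimensional metallic semi-Riemannian manifold: $\bar g$ is a semi-Riemannian metric and $\bar J$ a smooth $(1,1)$-tensor field with $\bar J^2=p\bar J+qI$ and $\bar g(U,\bar JV)=\bar g(\bar JU,V)$. Let $\bar\nabla$ be the Levi-Civita connection of $\bar g$, let $\eta$ be a smooth vector field on $\bar M$, $\pi(V)=\bar g(V,\eta)$, and let $$\bar D_UV=\bar\nabla_UV+\pi(V)\bar JU$$ be the associated quarter symmetric connection. Let $M$ be an (immersed) $r$-lightlike submanifold of $\bar M$, $r>0$: $Rad(TM)=TM\cap TM^{\perp}$ is a smooth distribution of rank $r$. Let $S(TM)$ be a screen distribution (a smooth complement of $Rad(TM)$ in $TM$), $S(TM^\perp)$ a screen transversal bundle (a smooth complement of $Rad(TM)$ in $TM^\perp$), and $ltr(TM)$ a lightlike transversal bundle (a smooth, totally null complement of $Rad(TM)$ in the orthogonal complement of $S(TM^\perp)$ in $S(TM)^\perp$), so that $T\bar M|_M=TM\oplus ltr(TM)\oplus S(TM^\perp)$. For a section $V$ of $TM$ and a vector field $U$ on $M$, $\bar h^s(U,V)$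 denotes the component of $\bar D_UV$ in $S(TM^\perp)$ in this decomposition. Assume that $\bar J$ is parallel along $M$, i.e. $(\bar\nabla_U\bar J)V=0$ for all $U,V$ tangent to $M$ (this holds in particular if $\bar\nabla\bar J=0$), and that $M$ is screen semi-invariant: there is a smooth distribution $B\subseteq S(TM)$ such that, with $B^\perp$ the orthogonal complement of $B$ in $S(TM)$, $$S(TM)=B\oplus B^\perp,\quad \bar J(B)=B,\quad \bar J(B^\perp)\subseteq S(TM^\perp),\quad \bar J(Rad(TM))=Rad(TM).$$ Then the distribution $B'=B\perp Rad(TM)$ is integrable (that is, $[U,V]\in\Gamma(B')$ for all $U,V\in\Gamma(B')$) if and only if $$\bar h^s(U,\bar JV)=\bar h^s(V,\bar JU)\qquad\text{for all }U,V\in\Gamma(B).$$ -/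

import Mathlib

open Bundle Set
open scoped Manifold ContDiff Topology

noncomputable section

namespace LightlikeGeometry

/-! ### Linear algebra: the decomposition of a semi-Euclidean space along a subspace -/

/-- `ν` is the index of `b`: the largest dimension of a negative definite subspace. -/
def IsIndex {T : Type*} [AddCommGroup T] [Module ℝ T] (b : LinearMap.BilinForm ℝ T) (ν : ℕ) :
    Prop :=
  IsGreatest {k : ℕ | ∃ W : Submodule ℝ T, Module.finrank ℝ W = k ∧
    ∀ v ∈ W, v ≠ 0 → b v v < 0} ν

theorem isCompl_of_decomposition {T : Type*} [AddCommGroup T] [Module ℝ T]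
    [FiniteDimensional ℝ T] (b : LinearMap.BilinForm ℝ T) (hs : ∀ v w, b v w = b w v)
    (hn : ∀ v, (∀ w, b v w = 0) → v = 0) {A S N L : Submodule ℝ T}
    (hS : S ⊔ (A ⊓ b.orthogonal A) = A) (hS' : S ⊓ (A ⊓ b.orthogonal A) = ⊥)
    (hN : N ⊔ (A ⊓ b.orthogonal A) = b.orthogonal A) (hN' : N ⊓ (A ⊓ b.orthogonal A) = ⊥)
    (hL : L ⊔ (A ⊓ b.orthogonal A) = b.orthogonal S ⊓ b.orthogonal N) :
    IsCompl N (A ⊔ L) := by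
  have href : b.IsRefl := fun v w h => by rw [hs w v, h]
  have hnd : b.Nondegenerate :=
    ⟨hn, fun v hv => hn v fun w => by rw [hs]; exact hv w⟩
  have hSA : S ≤ A := by rw [← hS]; exact le_sup_left
  have hNA : N ≤ b.orthogonal A := by rw [← hN]; exact le_sup_left
  have dS : Disjoint S (b.orthogonal S) := by
    rw [disjoint_iff, eq_bot_iff, ← hS']
    rintro v ⟨h1, h2⟩
    refine ⟨h1, hSA h1, fun a ha => ?_⟩
    rw [← hS] at ha
    obtain ⟨s, hs1, t, ht, rfl⟩ := Submodule.mem_sup.1 ha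
    have e1 : b s v = 0 := h2 s hs1
    have e2 : b t v = 0 := by rw [hs]; exact ht.2 v (hSA h1)
    change b (s + t) v = 0
    rw [map_add, LinearMap.add_apply, e1, e2, add_zero]
  have dN : Disjoint N (b.orthogonal N) := by
    rw [disjoint_iff, eq_bot_iff, ← hN']
    rintro v ⟨h1, h2⟩
    refine ⟨h1, ?_, hNA h1⟩
    have hv : v ∈ b.orthogonal (b.orthogonal A) := by
      intro a ha
      rw [← hN] at ha
      obtain ⟨s, hs1, t, ht, rfl⟩ := Submodule.mem_sup.1 ha
      have e1 : b s v = 0 := h2 s hs1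
      have e2 : b t v = 0 := hNA h1 t ht.1
      change b (s + t) v = 0
      rw [map_add, LinearMap.add_apply, e1, e2, add_zero]
    rwa [LinearMap.BilinForm.orthogonal_orthogonal hnd href] at hv
  have cS := (LinearMap.BilinForm.isCompl_orthogonal_iff_disjoint href).2 dS
  have cN := (LinearMap.BilinForm.isCompl_orthogonal_iff_disjoint href).2 dN
  constructor
  · rw [disjoint_iff, eq_bot_iff, ← disjoint_iff.1 dN]
    rintro y ⟨h1, h2⟩
    refine ⟨h1, fun w hw => ?_⟩
    obtain ⟨a, ha, l, hl, rfl⟩ := Submodule.mem_sup.1 h2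
    have e1 : b w a = 0 := by rw [hs]; exact hNA hw a ha
    have hl' : l ∈ b.orthogonal S ⊓ b.orthogonal N := by
      rw [← hL]; exact Submodule.mem_sup_left hl
    have e2 : b w l = 0 := hl'.2 w hw
    change b w (a + l) = 0
    rw [map_add, e1, e2, add_zero]
  · rw [codisjoint_iff, eq_top_iff]
    rintro x -
    have hx : x ∈ S ⊔ b.orthogonal S := by rw [cS.sup_eq_top]; trivial
    obtain ⟨s, hs1, t, ht, rfl⟩ := Submodule.mem_sup.1 hx
    have ht' : t ∈ N ⊔ b.orthogonal N := by rw [cN.sup_eq_top]; trivial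
    obtain ⟨w, hw, u, hu, rfl⟩ := Submodule.mem_sup.1 ht'
    have hu' : u ∈ L ⊔ (A ⊓ b.orthogonal A) := by
      rw [hL]
      refine ⟨?_, hu⟩
      have hwS : w ∈ b.orthogonal S := fun s hs => hNA hw s (hSA hs)
      have := (b.orthogonal S).sub_mem ht hwS
      rwa [add_sub_cancel_left] at this
    obtain ⟨l, hl, a, ha, rfl⟩ := Submodule.mem_sup.1 hu'
    have : s + (w + (l + a)) = w + ((s + a) + l) := by abel
    rw [this]
    exact Submodule.add_mem_sup hw
      (Submodule.add_mem_sup (A.add_mem (hSA hs1) ha.1) hl)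

/-! ### Semi-Riemannian metrics and connections

Manifolds are modelled on a finite-dimensional real vector space `E`, without boundary. -/

section Ambient

variable (E : Type*) [NormedAddCommGroup E] [NormedSpace ℝ E]
  (X : Type*) [TopologicalSpace X] [ChartedSpace E X] [IsManifold 𝓘(ℝ, E) ∞ X]

/-- Smoothness of a vector field. -/
def IsSmoothField (V : ∀ z : X, TangentSpace 𝓘(ℝ, E) z) : Prop :=
  ContMDiff 𝓘(ℝ, E) (𝓘(ℝ, E).prod 𝓘(ℝ, E)) ∞
    (fun z => (TotalSpace.mk' E z (V z) : TangentBundle 𝓘(ℝ, E) X))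

/-- A smooth semi-Riemannian metric: a smooth field of nondegenerate symmetric bilinear forms of
constant index on the tangent spaces. -/
structure SemiRiemannianMetric where
  val : ∀ z : X, TangentSpace 𝓘(ℝ, E) z →L[ℝ] TangentSpace 𝓘(ℝ, E) z →L[ℝ] ℝ
  contMDiff : ContMDiff 𝓘(ℝ, E) (𝓘(ℝ, E).prod 𝓘(ℝ, E →L[ℝ] E →L[ℝ] ℝ)) ∞
    (fun z => TotalSpace.mk' (E →L[ℝ] E →L[ℝ] ℝ)
      (E := fun z : X => TangentSpace 𝓘(ℝ, E) z →L[ℝ] TangentSpace 𝓘(ℝ, E) z →L[ℝ] ℝ) z (val z))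
  symm : ∀ z v w, val z v w = val z w v
  nondegenerate : ∀ z v, (∀ w, val z v w = 0) → v = 0
  exists_index : ∃ ν : ℕ, ∀ z,
    IsIndex (LinearMap.mk₂ ℝ (fun v w => val z v w) (by simp) (by simp) (by simp) (by simp)) ν

variable {E X}

/-- The metric at a point as an algebraic bilinear form. -/
def SemiRiemannianMetric.bilin (g : SemiRiemannianMetric E X) (z : X) :
    LinearMap.BilinForm ℝ (TangentSpace 𝓘(ℝ, E) z) :=
  LinearMap.mk₂ ℝ (fun v w => g.val z v w) (by simp) (by simp) (by simp) (by simp)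

/-- The orthogonal complement of a subspace of a tangent space. -/
def SemiRiemannianMetric.orth (g : SemiRiemannianMetric E X) (z : X)
    (F : Submodule ℝ (TangentSpace 𝓘(ℝ, E) z)) : Submodule ℝ (TangentSpace 𝓘(ℝ, E) z) :=
  (g.bilin z).orthogonal F

/-- Covariant derivatives on the tangent bundle: `D V z u` is the derivative of the vector field
`V` at `z` in the direction `u`. -/
abbrev AffineConnection (E : Type*) [NormedAddCommGroup E] [NormedSpace ℝ E]
    (X : Type*) [TopologicalSpace X] [ChartedSpace E X] [IsManifold 𝓘(ℝ, E) ∞ X] :=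
  CovariantDerivative 𝓘(ℝ, E) E (TangentSpace 𝓘(ℝ, E) : X → Type _)

/-- `D` is the Levi-Civita connection of `g`: it is torsion-free and metric. -/
structure IsLeviCivita (g : SemiRiemannianMetric E X) (D : AffineConnection E X) : Prop where
  torsion_free : ∀ (U V : ∀ z : X, TangentSpace 𝓘(ℝ, E) z) (z : X),
    MDifferentiableAt 𝓘(ℝ, E) (𝓘(ℝ, E).prod 𝓘(ℝ, E))
      (fun y => (TotalSpace.mk' E y (U y) : TangentBundle 𝓘(ℝ, E) X)) z →
    MDifferentiableAt 𝓘(ℝ, E) (𝓘(ℝ, E).prod 𝓘(ℝ, E))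
      (fun y => (TotalSpace.mk' E y (V y) : TangentBundle 𝓘(ℝ, E) X)) z →
    D V z (U z) - D U z (V z) = VectorField.mlieBracket 𝓘(ℝ, E) U V z
  metric : ∀ (V W : ∀ z : X, TangentSpace 𝓘(ℝ, E) z) (z : X) (u : TangentSpace 𝓘(ℝ, E) z),
    MDifferentiableAt 𝓘(ℝ, E) (𝓘(ℝ, E).prod 𝓘(ℝ, E))
      (fun y => (TotalSpace.mk' E y (V y) : TangentBundle 𝓘(ℝ, E) X)) z →
    MDifferentiableAt 𝓘(ℝ, E) (𝓘(ℝ, E).prod 𝓘(ℝ, E))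
      (fun y => (TotalSpace.mk' E y (W y) : TangentBundle 𝓘(ℝ, E) X)) z →
    mvfderiv 𝓘(ℝ, E) (fun y => g.val y (V y) (W y)) z u
      = g.val z (D V z u) (W z) + g.val z (V z) (D W z u)

/-- A metallic structure compatible with `g`: a smooth `(1,1)`-tensor field `J` with
`J² = p J + q I` and `g(U, J V) = g(J U, V)`. -/
structure MetallicStructure (g : SemiRiemannianMetric E X) (p q : ℕ) where
  toFun : ∀ z : X, TangentSpace 𝓘(ℝ, E) z →L[ℝ] TangentSpace 𝓘(ℝ, E) z
  contMDiff : ContMDiff 𝓘(ℝ, E) (𝓘(ℝ, E).prod 𝓘(ℝ, E →L[ℝ] E)) ∞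
    (fun z => TotalSpace.mk' (E →L[ℝ] E)
      (E := fun z : X => TangentSpace 𝓘(ℝ, E) z →L[ℝ] TangentSpace 𝓘(ℝ, E) z) z (toFun z))
  sq : ∀ z v, toFun z (toFun z v) = (p : ℝ) • toFun z v + (q : ℝ) • v
  compatible : ∀ z u v, g.val z u (toFun z v) = g.val z (toFun z u) v

/-- The quarter symmetric connection `D_U V = ∇_U V + π(V) J U`, where `π(V) = g(η, V)`. -/
def quarterSymmetric (g : SemiRiemannianMetric E X) {p q : ℕ} (J : MetallicStructure g p q)
    (nabla : AffineConnection E X) (η : ∀ z : X, TangentSpace 𝓘(ℝ, E) z) : AffineConnection E X :=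
  nabla.addOneForm fun z => (g.val z (η z)).smulRight (J.toFun z)

end Ambient

/-! ### Lightlike submanifolds

`i : M → X` is the immersion; subbundles of `TX|_M` are families of subspaces of `T_{i x} X`. -/

section Submanifold

variable {E : Type*} [NormedAddCommGroup E] [NormedSpace ℝ E]
  {X : Type*} [TopologicalSpace X] [ChartedSpace E X] [IsManifold 𝓘(ℝ, E) ∞ X]
  {E' : Type*} [NormedAddCommGroup E'] [NormedSpace ℝ E']
  {M : Type*} [TopologicalSpace M] [ChartedSpace E' M]

/-- The image in `T_{i x} X` of the tangent space of `M` at `x`. -/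
def tangentImage (i : M → X) (x : M) : Submodule ℝ (TangentSpace 𝓘(ℝ, E) (i x)) :=
  LinearMap.range (mfderiv 𝓘(ℝ, E') 𝓘(ℝ, E) i x).toLinearMap

/-- The family `F` is a smooth vector subbundle of `TX|_M`: it has smooth local frames. -/
def IsSmoothSubbundle (i : M → X) (F : ∀ x : M, Submodule ℝ (TangentSpace 𝓘(ℝ, E) (i x))) : Prop :=
  ∀ x₀ : M, ∃ W ∈ 𝓝 x₀, ∃ (k : ℕ) (s : Fin k → ∀ x : M, TangentSpace 𝓘(ℝ, E) (i x)),
    (∀ j, ContMDiffOn 𝓘(ℝ, E') (𝓘(ℝ, E).prod 𝓘(ℝ, E)) ∞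
      (fun x => (TotalSpace.mk' E (i x) (s j x) : TangentBundle 𝓘(ℝ, E) X)) W) ∧
    ∀ x ∈ W, LinearIndependent ℝ (fun j => s j x) ∧
      Submodule.span ℝ (Set.range fun j => s j x) = F x

/-- The covariant derivative along `i` of a section `V` of `TX|_M`, that is, the connection induced
by `D` on `TX|_M`. In the local frame `e_a` of `TX` given by the trivialization centred at `i x`,
with `V = ∑ V^a e_a`, it is `u ↦ ∑ (d V^a)(u) e_a + V^a(x) D_{di(u)} e_a`. -/
def covAlong (D : AffineConnection E X) (i : M → X) (V : ∀ x : M, TangentSpace 𝓘(ℝ, E) (i x))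
    (x : M) (u : TangentSpace 𝓘(ℝ, E') x) : TangentSpace 𝓘(ℝ, E) (i x) :=
  (trivializationAt E (TangentSpace 𝓘(ℝ, E)) (i x)).symmL ℝ (i x)
      (mvfderiv 𝓘(ℝ, E') (fun y =>
        (trivializationAt E (TangentSpace 𝓘(ℝ, E)) (i x)).continuousLinearMapAt ℝ (i y) (V y)) x u)
    + D (FiberBundle.extend E (V x)) (i x) (mfderiv 𝓘(ℝ, E') 𝓘(ℝ, E) i x u)

/-- `J` is parallel along `M`: `(∇_U J) V = 0` for all `U`, `V` tangent to `M`, where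
`(∇_U J) V = ∇_U (J V) - J (∇_U V)`. -/
def IsParallelAlong {g : SemiRiemannianMetric E X} {p q : ℕ} (J : MetallicStructure g p q)
    (nabla : AffineConnection E X) (i : M → X) : Prop :=
  ∀ (x : M) (u : TangentSpace 𝓘(ℝ, E') x) (V : ∀ z : X, TangentSpace 𝓘(ℝ, E) z),
    MDifferentiableAt 𝓘(ℝ, E) (𝓘(ℝ, E).prod 𝓘(ℝ, E))
      (fun y => (TotalSpace.mk' E y (V y) : TangentBundle 𝓘(ℝ, E) X)) (i x) →
    V (i x) ∈ tangentImage (E' := E') i x →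
    nabla (fun z => J.toFun z (V z)) (i x) (mfderiv 𝓘(ℝ, E') 𝓘(ℝ, E) i x u)
      = J.toFun (i x) (nabla V (i x) (mfderiv 𝓘(ℝ, E') 𝓘(ℝ, E) i x u))

/-- `i : M → X` is an `r`-lightlike submanifold, with chosen screen distribution `S(TM)`, screen
transversal bundle `S(TM^⊥)` and lightlike transversal bundle `ltr(TM)`. -/
structure LightlikeSubmanifold (E' : Type*) [NormedAddCommGroup E'] [NormedSpace ℝ E']
    {M : Type*} [TopologicalSpace M] [ChartedSpace E' M]
    (g : SemiRiemannianMetric E X) (i : M → X) (r : ℕ) where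
  contMDiff : ContMDiff 𝓘(ℝ, E') 𝓘(ℝ, E) ∞ i
  immersion : ∀ x, Function.Injective (mfderiv 𝓘(ℝ, E') 𝓘(ℝ, E) i x)
  r_pos : 0 < r
  /-- The radical distribution `Rad(TM) = TM ∩ TM^⊥`. -/
  rad : ∀ x : M, Submodule ℝ (TangentSpace 𝓘(ℝ, E) (i x))
  rad_eq : ∀ x, rad x = tangentImage (E' := E') i x ⊓ g.orth (i x) (tangentImage (E' := E') i x)
  rad_smooth : IsSmoothSubbundle (E' := E') i rad
  finrank_rad : ∀ x, Module.finrank ℝ (rad x) = r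
  /-- The screen distribution, a complement of `Rad(TM)` in `TM`. -/
  screen : ∀ x : M, Submodule ℝ (TangentSpace 𝓘(ℝ, E) (i x))
  screen_smooth : IsSmoothSubbundle (E' := E') i screen
  screen_sup_rad : ∀ x, screen x ⊔ rad x = tangentImage (E' := E') i x
  screen_inf_rad : ∀ x, screen x ⊓ rad x = ⊥
  /-- The screen transversal bundle, a complement of `Rad(TM)` in `TM^⊥`. -/
  screenTr : ∀ x : M, Submodule ℝ (TangentSpace 𝓘(ℝ, E) (i x))
  screenTr_smooth : IsSmoothSubbundle (E' := E') i screenTr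
  screenTr_sup_rad : ∀ x, screenTr x ⊔ rad x = g.orth (i x) (tangentImage (E' := E') i x)
  screenTr_inf_rad : ∀ x, screenTr x ⊓ rad x = ⊥
  /-- The lightlike transversal bundle, a totally null complement of `Rad(TM)` in the orthogonal
  complement of `S(TM^⊥)` in `S(TM)^⊥`. -/
  ltr : ∀ x : M, Submodule ℝ (TangentSpace 𝓘(ℝ, E) (i x))
  ltr_smooth : IsSmoothSubbundle (E' := E') i ltr
  ltr_sup_rad : ∀ x, ltr x ⊔ rad x = g.orth (i x) (screen x) ⊓ g.orth (i x) (screenTr x)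
  ltr_inf_rad : ∀ x, ltr x ⊓ rad x = ⊥
  ltr_null : ∀ x, ∀ v ∈ ltr x, ∀ w ∈ ltr x, g.val (i x) v w = 0

namespace LightlikeSubmanifold

variable {g : SemiRiemannianMetric E X} {i : M → X} {r : ℕ}

/-- `TX|_M = S(TM^⊥) ⊕ (TM ⊕ ltr(TM))`. -/
theorem isCompl_screenTr [FiniteDimensional ℝ E] (S : LightlikeSubmanifold E' g i r) (x : M) :
    IsCompl (S.screenTr x) (tangentImage (E' := E') i x ⊔ S.ltr x) := by
  have : FiniteDimensional ℝ (TangentSpace 𝓘(ℝ, E) (i x)) := inferInstanceAs (FiniteDimensional ℝ E)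
  have h := S.rad_eq x
  have h1 := S.screen_sup_rad x
  have h2 := S.screen_inf_rad x
  have h3 := S.screenTr_sup_rad x
  have h4 := S.screenTr_inf_rad x
  have h5 := S.ltr_sup_rad x
  rw [h] at h1 h2 h3 h4 h5
  exact isCompl_of_decomposition (g.bilin (i x)) (fun v w => g.symm (i x) v w)
    (fun v hv => g.nondegenerate (i x) v hv) h1 h2 h3 h4 h5

/-- The second fundamental form `h^s(U, V)` with respect to the connection `D`: the component in
`S(TM^⊥)` of `D_U V` in the decomposition `TX|_M = TM ⊕ ltr(TM) ⊕ S(TM^⊥)`. -/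
def hs [FiniteDimensional ℝ E] (S : LightlikeSubmanifold E' g i r) (D : AffineConnection E X)
    (U : ∀ x : M, TangentSpace 𝓘(ℝ, E') x) (V : ∀ x : M, TangentSpace 𝓘(ℝ, E) (i x)) (x : M) :
    TangentSpace 𝓘(ℝ, E) (i x) :=
  (S.screenTr x).projection _ (S.isCompl_screenTr x) (covAlong D i V x (U x))

/-- The orthogonal complement `B^⊥` of `B` in `S(TM)`. -/
def perpInScreen (S : LightlikeSubmanifold E' g i r)
    (B : ∀ x : M, Submodule ℝ (TangentSpace 𝓘(ℝ, E) (i x))) (x : M) :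
    Submodule ℝ (TangentSpace 𝓘(ℝ, E) (i x)) :=
  S.screen x ⊓ g.orth (i x) (B x)

/-- `M` is a screen semi-invariant lightlike submanifold, with invariant distribution `B`. -/
structure IsScreenSemiInvariant (S : LightlikeSubmanifold E' g i r) {p q : ℕ}
    (J : MetallicStructure g p q) (B : ∀ x : M, Submodule ℝ (TangentSpace 𝓘(ℝ, E) (i x))) :
    Prop where
  smooth : IsSmoothSubbundle (E' := E') i B
  le_screen : ∀ x, B x ≤ S.screen x
  sup_perp : ∀ x, B x ⊔ S.perpInScreen B x = S.screen x
  inf_perp : ∀ x, B x ⊓ S.perpInScreen B x = ⊥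
  map_B : ∀ x, (B x).map (J.toFun (i x)).toLinearMap = B x
  map_perp : ∀ x, (S.perpInScreen B x).map (J.toFun (i x)).toLinearMap ≤ S.screenTr x
  map_rad : ∀ x, (S.rad x).map (J.toFun (i x)).toLinearMap = S.rad x

end LightlikeSubmanifold

variable [IsManifold 𝓘(ℝ, E') ∞ M]

/-- `U ∈ Γ(F)`: `U` is a smooth vector field on `M` with values in the distribution `F ⊆ TM`. -/
def IsSectionOf (i : M → X) (F : ∀ x : M, Submodule ℝ (TangentSpace 𝓘(ℝ, E) (i x)))
    (U : ∀ x : M, TangentSpace 𝓘(ℝ, E') x) : Prop :=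
  IsSmoothField E' M U ∧ ∀ x, mfderiv 𝓘(ℝ, E') 𝓘(ℝ, E) i x (U x) ∈ F x

/-- The distribution `F ⊆ TM` is integrable: `[U, V] ∈ Γ(F)` for all `U, V ∈ Γ(F)`. -/
def IsIntegrable (E' : Type*) [NormedAddCommGroup E'] [NormedSpace ℝ E']
    {M : Type*} [TopologicalSpace M] [ChartedSpace E' M]
    [IsManifold 𝓘(ℝ, E') ∞ M] (i : M → X)
    (F : ∀ x : M, Submodule ℝ (TangentSpace 𝓘(ℝ, E) (i x))) : Prop :=
  ∀ U V : ∀ x : M, TangentSpace 𝓘(ℝ, E') x, IsSectionOf i F U → IsSectionOf i F V →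
    IsSectionOf i F (VectorField.mlieBracket 𝓘(ℝ, E') U V)

end Submanifold

end LightlikeGeometry

end

/-!
The distribution `B' = B ⊥ Rad(TM)` is studied through the second fundamental forms
`h(u, v, ν) = g(∇_u V, ν)` of the immersion, `ν` normal to `M` (`secondForm`). They are symmetric
and tensorial, because the connection induced on `TX|_M` satisfies the torsion formula
`∇_U di(V) - ∇_V di(U) = di([U, V])` (`IsLeviCivita.torsion_along`).

As `J` is parallel along `M`, `∇_U (J V) - ∇_V (J U) = J [U, V]` (`covAlong_apply_sub`). For
`U, V ∈ Γ(B)` the extra terms `π(J V) J U` and `π(J U) J V` of the quarter symmetric connection are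
tangent to `M`, so the difference of the two sides of the `h^s`-condition is the
`S(TM^⊥)`-component of `J [U, V]`. This is `J c`, where `c` is the `B^⊥`-component of `[U, V]`, and
`J` is injective since `q ≠ 0`. So the `h^s`-condition for `U, V ∈ Γ(B)` says precisely that
`[U, V] ∈ Γ(B')` (`hs_eq_iff`). In particular it follows from the integrability of `B'`.

Conversely, let `U, V ∈ Γ(B')`. For `w ∈ B^⊥` the vector `J w` is normal to `M`, and
`g(J [U, V], J w) = h(U, J V, J w) - h(V, J U, J w)`; if this vanishes for all `w ∈ B^⊥`, then
`[U, V] ∈ B'` (`mem_sup_of_metric_apply`). By bilinearity it vanishes as soon as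
`h(u, J v, J w) = h(v, J u, J w)` in two cases: for `u, v ∈ B`, where it follows from the hypothesis,
applied to sections of `B` through `u` and `v`; and for `u ∈ B'`, `v = ξ ∈ Rad(TM)`, where it always
holds, since both sides are equal to `-h(u, w, J² ξ)` (`secondForm_apply_rad`).

Two facts of general nature are needed on the way: each vector of a smooth distribution extends to
a global section (`exists_isSectionOf`), and a vector field on `M` is smooth if its image under the
immersion is a smooth section of `TX|_M` (`SmoothAlongAt.contMDiffAt_of_push`).
-/

noncomputable section

namespace LightlikeGeometry

/-! ### The Lie bracket and second derivatives of vector-valued maps -/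

section Torsion

variable {E' : Type*} [NormedAddCommGroup E'] [NormedSpace ℝ E'] [FiniteDimensional ℝ E']
  {M : Type*} [TopologicalSpace M] [ChartedSpace E' M] [IsManifold 𝓘(ℝ, E') ∞ M]
  {F : Type*} [NormedAddCommGroup F] [NormedSpace ℝ F]

/-- The vector field `V` in the chart centred at `x`. -/
def chartField (x : M) (V : ∀ y : M, TangentSpace 𝓘(ℝ, E') y) (z : E') : E' :=
  mfderiv 𝓘(ℝ, E') 𝓘(ℝ, E') (extChartAt 𝓘(ℝ, E') x) ((extChartAt 𝓘(ℝ, E') x).symm z)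
    (V ((extChartAt 𝓘(ℝ, E') x).symm z))

omit [FiniteDimensional ℝ E'] in
theorem chartField_eventuallyEq (x : M) (V : ∀ y : M, TangentSpace 𝓘(ℝ, E') y) :
    chartField x V =ᶠ[𝓝 (extChartAt 𝓘(ℝ, E') x x)]
      VectorField.mpullbackWithin 𝓘(ℝ, E') 𝓘(ℝ, E') (extChartAt 𝓘(ℝ, E') x).symm V
        (range 𝓘(ℝ, E')) := by
  filter_upwards [extChartAt_target_mem_nhds (I := 𝓘(ℝ, E')) x] with z hz
  have h1 := mfderivWithin_extChartAt_symm_comp_mfderiv_extChartAt (I := 𝓘(ℝ, E')) hz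
  have h2 := mfderiv_extChartAt_comp_mfderivWithin_extChartAt_symm (I := 𝓘(ℝ, E')) hz
  rw [VectorField.mpullbackWithin_apply, ContinuousLinearMap.inverse_eq h1 h2]
  rfl

omit [FiniteDimensional ℝ E'] in
theorem chartField_self (x : M) (V : ∀ y : M, TangentSpace 𝓘(ℝ, E') y) :
    chartField x V (extChartAt 𝓘(ℝ, E') x x) = V x := by
  rw [chartField, extChartAt_to_inv, mfderiv_extChartAt_self]
  rfl

theorem differentiableAt_chartField {x : M} {V : ∀ y : M, TangentSpace 𝓘(ℝ, E') y}
    (hV : MDifferentiableAt 𝓘(ℝ, E') (𝓘(ℝ, E').prod 𝓘(ℝ, E'))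
      (fun y => (TotalSpace.mk' E' y (V y) : TangentBundle 𝓘(ℝ, E') M)) x) :
    DifferentiableAt ℝ (chartField x V) (extChartAt 𝓘(ℝ, E') x x) := by
  have : IsManifold 𝓘(ℝ, E') 2 M := IsManifold.of_le (n := ∞) ENat.LEInfty.out
  refine DifferentiableAt.congr_of_eventuallyEq ?_ (chartField_eventuallyEq x V)
  have := MDifferentiableWithinAt.differentiableWithinAt_mpullbackWithin_vectorField
    (mdifferentiableWithinAt_univ.2 hV)
  rw [preimage_univ, univ_inter, show range 𝓘(ℝ, E') = univ by simp] at this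
  rw [show range 𝓘(ℝ, E') = univ by simp]
  exact differentiableWithinAt_univ.1 this

omit [FiniteDimensional ℝ E'] in
theorem mlieBracket_eq_chartField (x : M) (U V : ∀ y : M, TangentSpace 𝓘(ℝ, E') y) :
    VectorField.mlieBracket 𝓘(ℝ, E') U V x
      = VectorField.lieBracket ℝ (chartField x U) (chartField x V) (extChartAt 𝓘(ℝ, E') x x) := by
  rw [(chartField_eventuallyEq x U).lieBracket_vectorField_eq (chartField_eventuallyEq x V),
    VectorField.mlieBracket, VectorField.mlieBracketWithin_apply, preimage_univ, univ_inter,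
    show range 𝓘(ℝ, E') = univ by simp]
  have h : (mfderiv 𝓘(ℝ, E') 𝓘(ℝ, E') (extChartAt 𝓘(ℝ, E') x) x).inverse
      = ContinuousLinearMap.id ℝ E' := by
    rw [mfderiv_extChartAt_self]; exact ContinuousLinearMap.inverse_id
  erw [h, VectorField.lieBracketWithin_univ]
  rfl

omit [FiniteDimensional ℝ E'] in
/-- In a chart, the derivative of `φ` along a vector field is computed by the local
representative of `φ` and the vector field read in the chart. -/
theorem mvfderiv_apply_eventuallyEq_chart {φ : M → F} {x : M}
    (hφ : ContMDiffAt 𝓘(ℝ, E') 𝓘(ℝ, F) ∞ φ x) (V : ∀ y : M, TangentSpace 𝓘(ℝ, E') y) :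
    (fun y => mvfderiv 𝓘(ℝ, E') φ y (V y)) =ᶠ[𝓝 x]
      (fun z : E' => fderiv ℝ (φ ∘ (extChartAt 𝓘(ℝ, E') x).symm) z (chartField x V z))
        ∘ extChartAt 𝓘(ℝ, E') x := by
  have h0 : ContMDiffAt 𝓘(ℝ, E') 𝓘(ℝ, F) 1 φ x := hφ.of_le (by simp)
  have : IsManifold 𝓘(ℝ, E') 1 M := IsManifold.of_le (n := ∞) (by simp)
  have h1 : ∀ᶠ y in 𝓝 x, ContMDiffAt 𝓘(ℝ, E') 𝓘(ℝ, F) 1 φ y := 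
    (contMDiffAt_iff_contMDiffAt_nhds (by simp)).1 h0
  filter_upwards [h1, extChartAt_source_mem_nhds (I := 𝓘(ℝ, E')) x] with y hy hys
  have ht := (extChartAt 𝓘(ℝ, E') x).map_source hys
  have hinv := (extChartAt 𝓘(ℝ, E') x).left_inv hys
  have hr : range 𝓘(ℝ, E') = univ := by simp
  have hsd : MDifferentiableAt 𝓘(ℝ, E') 𝓘(ℝ, E') (extChartAt 𝓘(ℝ, E') x).symm
      (extChartAt 𝓘(ℝ, E') x y) := by
    have := mdifferentiableWithinAt_extChartAt_symm (I := 𝓘(ℝ, E')) ht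
    rwa [hr, mdifferentiableWithinAt_univ] at this
  have hφd : MDifferentiableAt 𝓘(ℝ, E') 𝓘(ℝ, F) φ
      ((extChartAt 𝓘(ℝ, E') x).symm (extChartAt 𝓘(ℝ, E') x y)) := by
    rw [hinv]; exact hy.mdifferentiableAt one_ne_zero
  have hcomp := mfderiv_comp (extChartAt 𝓘(ℝ, E') x y) hφd hsd
  have h2 := mfderivWithin_extChartAt_symm_comp_mfderiv_extChartAt (I := 𝓘(ℝ, E')) ht
  rw [mfderiv_eq_fderiv] at hcomp
  rw [hr, mfderivWithin_univ] at h2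
  have h3 := congr($h2 (V ((extChartAt 𝓘(ℝ, E') x).symm (extChartAt 𝓘(ℝ, E') x y))))
  have h4 : fderiv ℝ (φ ∘ (extChartAt 𝓘(ℝ, E') x).symm) (extChartAt 𝓘(ℝ, E') x y)
      (chartField x V (extChartAt 𝓘(ℝ, E') x y))
      = mvfderiv 𝓘(ℝ, E') φ ((extChartAt 𝓘(ℝ, E') x).symm (extChartAt 𝓘(ℝ, E') x y))
        (V ((extChartAt 𝓘(ℝ, E') x).symm (extChartAt 𝓘(ℝ, E') x y))) := by
    rw [hcomp]
    exact congrArg (mvfderiv 𝓘(ℝ, E') φ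
      ((extChartAt 𝓘(ℝ, E') x).symm (extChartAt 𝓘(ℝ, E') x y))) h3
  rw [Function.comp_apply, h4, hinv]

/-- Symmetry of second derivatives: for a map `φ` into a vector space,
`U (dφ(V)) - V (dφ(U)) = dφ([U, V])`. -/
theorem mvfderiv_mlieBracket {φ : M → F} {x : M}
    (hφ : ContMDiffAt 𝓘(ℝ, E') 𝓘(ℝ, F) ∞ φ x) {U V : ∀ y : M, TangentSpace 𝓘(ℝ, E') y}
    (hU : MDifferentiableAt 𝓘(ℝ, E') (𝓘(ℝ, E').prod 𝓘(ℝ, E'))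
      (fun y => (TotalSpace.mk' E' y (U y) : TangentBundle 𝓘(ℝ, E') M)) x)
    (hV : MDifferentiableAt 𝓘(ℝ, E') (𝓘(ℝ, E').prod 𝓘(ℝ, E'))
      (fun y => (TotalSpace.mk' E' y (V y) : TangentBundle 𝓘(ℝ, E') M)) x) :
    mvfderiv 𝓘(ℝ, E') (fun y => mvfderiv 𝓘(ℝ, E') φ y (V y)) x (U x)
      - mvfderiv 𝓘(ℝ, E') (fun y => mvfderiv 𝓘(ℝ, E') φ y (U y)) x (V x)
      = mvfderiv 𝓘(ℝ, E') φ x (VectorField.mlieBracket 𝓘(ℝ, E') U V x) := by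
  have hr : range 𝓘(ℝ, E') = univ := by simp
  let f : E' → F := φ ∘ (extChartAt 𝓘(ℝ, E') x).symm
  obtain ⟨z, hz⟩ : ∃ z : E', z = extChartAt 𝓘(ℝ, E') x x := ⟨_, rfl⟩
  have hf : ContDiffAt ℝ ∞ f z := by
    have := (contMDiffAt_iff.1 hφ).2
    rw [hr, contDiffWithinAt_univ, ← hz] at this
    exact this
  have hf' : DifferentiableAt ℝ (fderiv ℝ f) z :=
    (hf.fderiv_right (m := 1) (by norm_cast)).differentiableAt (by simp)
  have hD : ∀ V : ∀ y : M, TangentSpace 𝓘(ℝ, E') y,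
      MDifferentiableAt 𝓘(ℝ, E') (𝓘(ℝ, E').prod 𝓘(ℝ, E'))
        (fun y => (TotalSpace.mk' E' y (V y) : TangentBundle 𝓘(ℝ, E') M)) x → ∀ a : E',
      mvfderiv 𝓘(ℝ, E') (fun y => mvfderiv 𝓘(ℝ, E') φ y (V y)) x a
        = fderiv ℝ (fderiv ℝ f) z a (chartField x V z)
          + fderiv ℝ f z (fderiv ℝ (chartField x V) z a) := by
    intro V hV a
    have h1 := mvfderiv_apply_eventuallyEq_chart hφ V
    have h2 : HasFDerivAt (fun z => fderiv ℝ f z (chartField x V z)) _ z :=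
      hf'.hasFDerivAt.clm_apply (hz ▸ differentiableAt_chartField hV).hasFDerivAt
    have hψ := (mdifferentiableAt_extChartAt (I := 𝓘(ℝ, E')) (mem_chart_source E' x)).hasMFDerivAt
    rw [mfderiv_extChartAt_self] at hψ
    rw [hz] at h2
    have h3 := h2.hasMFDerivAt.comp x hψ
    have h4 := (h3.congr_of_eventuallyEq h1).mfderiv
    have h5 : mvfderiv 𝓘(ℝ, E') (fun y => mvfderiv 𝓘(ℝ, E') φ y (V y)) x a
      = mfderiv 𝓘(ℝ, E') 𝓘(ℝ, F) (fun y => mvfderiv 𝓘(ℝ, E') φ y (V y)) x a := rfl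
    rw [h5, h4, hz]
    exact add_comm _ _
  have hφx : ∀ a : E', mvfderiv 𝓘(ℝ, E') φ x a = fderiv ℝ f z a := by
    intro a
    rw [MDifferentiableAt.mvfderiv (hφ.mdifferentiableAt (by simp)), hr, fderivWithin_univ, hz]
    rfl
  have hs : IsSymmSndFDerivAt ℝ f z := hf.isSymmSndFDerivAt (by
    rw [minSmoothness_of_isRCLikeNormedField]; exact ENat.LEInfty.out)
  have hUz : chartField x U z = U x := by rw [hz, chartField_self]
  have hVz : chartField x V z = V x := by rw [hz, chartField_self]
  rw [mlieBracket_eq_chartField, ← hz, VectorField.lieBracket, ← hUz, ← hVz]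
  erw [hD V hV, hD U hU, hφx]
  rw [map_sub, hs.eq]
  abel

end Torsion

/-! ### Sections along a map and their covariant derivatives -/

section Along

variable {E : Type*} [NormedAddCommGroup E] [NormedSpace ℝ E]
  {X : Type*} [TopologicalSpace X] [ChartedSpace E X] [IsManifold 𝓘(ℝ, E) ∞ X]
  {E' : Type*} [NormedAddCommGroup E'] [NormedSpace ℝ E']
  {M : Type*} [TopologicalSpace M] [ChartedSpace E' M]

/-- Differentiability at `x` of the section `V` of `TX|_M`. -/
def MDiffAlongAt (E' : Type*) [NormedAddCommGroup E'] [NormedSpace ℝ E']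
    {M : Type*} [TopologicalSpace M] [ChartedSpace E' M] (i : M → X)
    (V : ∀ x : M, TangentSpace 𝓘(ℝ, E) (i x)) (x : M) : Prop :=
  MDifferentiableAt 𝓘(ℝ, E') (𝓘(ℝ, E).prod 𝓘(ℝ, E))
    (fun y => (TotalSpace.mk' E (i y) (V y) : TangentBundle 𝓘(ℝ, E) X)) x

/-- The coordinate expression near `x` of the section `V` of `TX|_M`, in the trivialization of
`TX` centred at `i x`. -/
def coordAlong (i : M → X) (V : ∀ x : M, TangentSpace 𝓘(ℝ, E) (i x)) (x y : M) : E :=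
  (trivializationAt E (TangentSpace 𝓘(ℝ, E)) (i x)).continuousLinearMapAt ℝ (i y) (V y)

variable {i : M → X} {V W : ∀ x : M, TangentSpace 𝓘(ℝ, E) (i x)} {x : M}

theorem coordAlong_eventuallyEq (hi : ContinuousAt i x) :
    coordAlong i V x =ᶠ[𝓝 x] fun y =>
      (trivializationAt E (TangentSpace 𝓘(ℝ, E)) (i x)
        (TotalSpace.mk' E (i y) (V y) : TangentBundle 𝓘(ℝ, E) X)).2 := by
  have h : ∀ᶠ y in 𝓝 x,
      i y ∈ (trivializationAt E (TangentSpace 𝓘(ℝ, E) : X → Type _) (i x)).baseSet :=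
    hi ((trivializationAt E (TangentSpace 𝓘(ℝ, E)) (i x)).open_baseSet.mem_nhds
      (FiberBundle.mem_baseSet_trivializationAt' (i x)))
  filter_upwards [h] with y hy
  exact congrFun ((trivializationAt E (TangentSpace 𝓘(ℝ, E)) (i x)).coe_linearMapAt_of_mem
    (R := ℝ) hy) (V y)

theorem mdiffAlongAt_iff :
    MDiffAlongAt E' i V x ↔ MDifferentiableAt 𝓘(ℝ, E') 𝓘(ℝ, E) i x ∧
      MDifferentiableAt 𝓘(ℝ, E') 𝓘(ℝ, E) (coordAlong i V x) x := by
  rw [MDiffAlongAt, mdifferentiableAt_totalSpace]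
  refine and_congr_right fun hi => ?_
  exact (coordAlong_eventuallyEq (V := V) hi.continuousAt).mdifferentiableAt_iff.symm

theorem MDiffAlongAt.base (hV : MDiffAlongAt E' i V x) :
    MDifferentiableAt 𝓘(ℝ, E') 𝓘(ℝ, E) i x := (mdiffAlongAt_iff.1 hV).1

theorem MDiffAlongAt.coord (hV : MDiffAlongAt E' i V x) :
    MDifferentiableAt 𝓘(ℝ, E') 𝓘(ℝ, E) (coordAlong i V x) x := (mdiffAlongAt_iff.1 hV).2

omit [TopologicalSpace M] in
theorem coordAlong_add : coordAlong i (fun y => V y + W y) x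
    = fun y => coordAlong i V x y + coordAlong i W x y := by
  ext y; exact map_add _ _ _

omit [TopologicalSpace M] in
theorem coordAlong_smul (f : M → ℝ) : coordAlong i (fun y => f y • V y) x
    = fun y => f y • coordAlong i V x y := by
  ext y; exact map_smul _ _ _

theorem MDiffAlongAt.add (hV : MDiffAlongAt E' i V x) (hW : MDiffAlongAt E' i W x) :
    MDiffAlongAt E' i (fun y => V y + W y) x := by
  rw [mdiffAlongAt_iff, coordAlong_add]
  exact ⟨hV.base, hV.coord.add hW.coord⟩

theorem MDiffAlongAt.smul {f : M → ℝ} (hf : MDifferentiableAt 𝓘(ℝ, E') 𝓘(ℝ, ℝ) f x)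
    (hV : MDiffAlongAt E' i V x) : MDiffAlongAt E' i (fun y => f y • V y) x := by
  rw [mdiffAlongAt_iff, coordAlong_smul]
  exact ⟨hV.base, hf.smul hV.coord⟩

theorem MDiffAlongAt.congr (h : V =ᶠ[𝓝 x] W) (hV : MDiffAlongAt E' i V x) :
    MDiffAlongAt E' i W x :=
  MDifferentiableAt.congr_of_eventuallyEq hV
    (h.mono fun y hy => by simp only [hy])

theorem MDiffAlongAt.comp {Z : ∀ z : X, TangentSpace 𝓘(ℝ, E) z}
    (hZ : MDifferentiableAt 𝓘(ℝ, E) (𝓘(ℝ, E).prod 𝓘(ℝ, E))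
      (fun y => (TotalSpace.mk' E y (Z y) : TangentBundle 𝓘(ℝ, E) X)) (i x))
    (hi : MDifferentiableAt 𝓘(ℝ, E') 𝓘(ℝ, E) i x) : MDiffAlongAt E' i (fun y => Z (i y)) x :=
  MDifferentiableAt.comp x hZ hi

variable (D : AffineConnection E X)

theorem extend_eq {z : X} (v : TangentSpace 𝓘(ℝ, E) z) {y : X}
    (hy : y ∈ (trivializationAt E (TangentSpace 𝓘(ℝ, E) : X → Type _) z).baseSet) :
    (FiberBundle.extend E v : ∀ y : X, TangentSpace 𝓘(ℝ, E) y) y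
      = (trivializationAt E (TangentSpace 𝓘(ℝ, E)) z).symmL ℝ y
        ((trivializationAt E (TangentSpace 𝓘(ℝ, E)) z).continuousLinearMapAt ℝ z v) := by
  have h := FiberBundle.mem_baseSet_trivializationAt' (F := E)
    (E := (TangentSpace 𝓘(ℝ, E) : X → Type _)) z
  simp only [FiberBundle.extend]
  rw [Trivialization.continuousLinearMapAt_apply, Trivialization.coe_linearMapAt_of_mem _ h]
  exact (Trivialization.symmₗ_apply _ hy _).symm

theorem connection_extend_add {z : X} (v w : TangentSpace 𝓘(ℝ, E) z) :
    D (FiberBundle.extend E (v + w)) z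
      = D (FiberBundle.extend E v) z + D (FiberBundle.extend E w) z := by
  have hd := fun v : TangentSpace 𝓘(ℝ, E) z =>
    FiberBundle.mdifferentiableAt_extend 𝓘(ℝ, E) E v
  rw [← D.isCovariantDerivativeOn.add (hd v) (hd w)]
  refine D.isCovariantDerivativeOn.congr_of_eventuallyEq (hd _)
    (mdifferentiableAt_add_section (hd v) (hd w)) Filter.univ_mem ?_
  filter_upwards [(trivializationAt E (TangentSpace 𝓘(ℝ, E)) z).open_baseSet.mem_nhds
    (FiberBundle.mem_baseSet_trivializationAt' z)] with y hy
  rw [Pi.add_apply, extend_eq _ hy, extend_eq _ hy, extend_eq _ hy, map_add, map_add]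

theorem connection_extend_smul {z : X} (c : ℝ) (v : TangentSpace 𝓘(ℝ, E) z) :
    D (FiberBundle.extend E (c • v)) z = c • D (FiberBundle.extend E v) z := by
  have hd := fun v : TangentSpace 𝓘(ℝ, E) z =>
    FiberBundle.mdifferentiableAt_extend 𝓘(ℝ, E) E v
  rw [← D.isCovariantDerivativeOn.smul_const c (hd v)]
  refine D.isCovariantDerivativeOn.congr_of_eventuallyEq (hd _)
    (mdifferentiableAt_const.smul_section (hd v)) Filter.univ_mem ?_
  filter_upwards [(trivializationAt E (TangentSpace 𝓘(ℝ, E)) z).open_baseSet.mem_nhds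
    (FiberBundle.mem_baseSet_trivializationAt' z)] with y hy
  rw [Pi.smul_apply, extend_eq _ hy, extend_eq _ hy, map_smul, map_smul]

theorem covAlong_eq (u : TangentSpace 𝓘(ℝ, E') x) :
    covAlong D i V x u = (trivializationAt E (TangentSpace 𝓘(ℝ, E)) (i x)).symmL ℝ (i x)
      (mvfderiv 𝓘(ℝ, E') (coordAlong i V x) x u)
      + D (FiberBundle.extend E (V x)) (i x) (mfderiv 𝓘(ℝ, E') 𝓘(ℝ, E) i x u) := rfl

theorem covAlong_add (hV : MDiffAlongAt E' i V x) (hW : MDiffAlongAt E' i W x)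
    (u : TangentSpace 𝓘(ℝ, E') x) :
    covAlong D i (fun y => V y + W y) x u = covAlong D i V x u + covAlong D i W x u := by
  have h : mvfderiv 𝓘(ℝ, E') (coordAlong i (fun y => V y + W y) x) x
      = mvfderiv 𝓘(ℝ, E') (coordAlong i V x) x + mvfderiv 𝓘(ℝ, E') (coordAlong i W x) x := by
    rw [coordAlong_add]; exact mvfderiv_add hV.coord hW.coord
  rw [covAlong_eq, covAlong_eq, covAlong_eq, h, connection_extend_add]
  simp only [add_apply, map_add]
  abel

omit [TopologicalSpace M] in
theorem symmL_coordAlong :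
    (trivializationAt E (TangentSpace 𝓘(ℝ, E)) (i x)).symmL ℝ (i x) (coordAlong i V x x) = V x :=
  (trivializationAt E (TangentSpace 𝓘(ℝ, E)) (i x)).symmL_continuousLinearMapAt
    (FiberBundle.mem_baseSet_trivializationAt' (i x)) (V x)

theorem covAlong_smul {f : M → ℝ} (hf : MDifferentiableAt 𝓘(ℝ, E') 𝓘(ℝ, ℝ) f x)
    (hV : MDiffAlongAt E' i V x) (u : TangentSpace 𝓘(ℝ, E') x) :
    covAlong D i (fun y => f y • V y) x u
      = f x • covAlong D i V x u + mvfderiv 𝓘(ℝ, E') f x u • V x := by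
  have h : mvfderiv 𝓘(ℝ, E') (coordAlong i (fun y => f y • V y) x) x u
      = f x • mvfderiv 𝓘(ℝ, E') (coordAlong i V x) x u
        + mvfderiv 𝓘(ℝ, E') f x u • coordAlong i V x x := by
    rw [coordAlong_smul]
    exact congr($(mvfderiv_smul hf hV.coord) u)
  rw [covAlong_eq, covAlong_eq, h, connection_extend_smul, map_add, map_smul,
    map_smul, symmL_coordAlong]
  simp only [smul_apply]
  module

theorem covAlong_congr (h : V =ᶠ[𝓝 x] W) (u : TangentSpace 𝓘(ℝ, E') x) :
    covAlong D i V x u = covAlong D i W x u := by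
  have h1 : coordAlong i V x =ᶠ[𝓝 x] coordAlong i W x :=
    h.mono fun y hy => by simp only [coordAlong, hy]
  have h2 : mvfderiv 𝓘(ℝ, E') (coordAlong i V x) x = mvfderiv 𝓘(ℝ, E') (coordAlong i W x) x := by
    simp only [mvfderiv, h1.mfderiv_eq]
    rfl
  rw [covAlong_eq, covAlong_eq, h2, h.eq_of_nhds]

/-- In the frame given by a trivialization, a covariant derivative is the derivative of the
components plus a term depending only on the value of the vector field at the point. -/
theorem connection_eq_coord [FiniteDimensional ℝ E] {z : X} {Z : ∀ z : X, TangentSpace 𝓘(ℝ, E) z}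
    (hZ : MDifferentiableAt 𝓘(ℝ, E) (𝓘(ℝ, E).prod 𝓘(ℝ, E))
      (fun y => (TotalSpace.mk' E y (Z y) : TangentBundle 𝓘(ℝ, E) X)) z)
    (a : TangentSpace 𝓘(ℝ, E) z) :
    D Z z a = (trivializationAt E (TangentSpace 𝓘(ℝ, E)) z).symmL ℝ z
      (mvfderiv 𝓘(ℝ, E) (coordAlong (id : X → X) Z z) z a)
      + D (FiberBundle.extend E (Z z)) z a := by
  -- the difference of `D` and the derivative of the components is tensorial
  let A : (∀ z : X, TangentSpace 𝓘(ℝ, E) z) → TangentSpace 𝓘(ℝ, E) z := fun Z =>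
    D Z z a - (trivializationAt E (TangentSpace 𝓘(ℝ, E)) z).symmL ℝ z
      (mvfderiv 𝓘(ℝ, E) (coordAlong (id : X → X) Z z) z a)
  have hA : TensorialAt 𝓘(ℝ, E) E A z := by
    constructor
    · intro f Z hf hZ
      have hZ' : MDiffAlongAt E (id : X → X) Z z := hZ
      have h : mvfderiv 𝓘(ℝ, E) (coordAlong (id : X → X) (f • Z) z) z a
          = f z • mvfderiv 𝓘(ℝ, E) (coordAlong (id : X → X) Z z) z a
            + mvfderiv 𝓘(ℝ, E) f z a • coordAlong (id : X → X) Z z z := by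
        have : coordAlong (id : X → X) (f • Z) z
            = fun y => f y • coordAlong (id : X → X) Z z y := coordAlong_smul f
        rw [this]
        exact congr($(mvfderiv_smul hf hZ'.coord) a)
      have h2 := symmL_coordAlong (i := (id : X → X)) (V := Z) (x := z)
      simp only [id] at h2
      simp only [A]
      rw [h, D.isCovariantDerivativeOn.leibniz hZ hf, map_add, map_smul, map_smul, h2]
      simp only [add_apply, smul_apply,
        ContinuousLinearMap.smulRight_apply]
      module
    · intro Z Z' hZ hZ'
      have hZ1 : MDiffAlongAt E (id : X → X) Z z := hZ
      have hZ2 : MDiffAlongAt E (id : X → X) Z' z := hZ'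
      have h : mvfderiv 𝓘(ℝ, E) (coordAlong (id : X → X) (Z + Z') z) z
          = mvfderiv 𝓘(ℝ, E) (coordAlong (id : X → X) Z z) z
            + mvfderiv 𝓘(ℝ, E) (coordAlong (id : X → X) Z' z) z := by
        have : coordAlong (id : X → X) (Z + Z') z
            = fun y => coordAlong (id : X → X) Z z y + coordAlong (id : X → X) Z' z y :=
          coordAlong_add
        rw [this]
        exact mvfderiv_add hZ1.coord hZ2.coord
      simp only [A]
      rw [h, D.isCovariantDerivativeOn.add hZ hZ']
      simp only [add_apply, map_add]
      abel
  have h := hA.pointwise hZ (FiberBundle.mdifferentiableAt_extend 𝓘(ℝ, E) E (Z z))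
    (FiberBundle.extend_apply_self _ _).symm
  -- `extend` has constant components, so its components have derivative zero
  let Z' : ∀ z : X, TangentSpace 𝓘(ℝ, E) z := FiberBundle.extend E (Z z)
  have hc : coordAlong (id : X → X) Z' z =ᶠ[𝓝 z]
      fun _ => coordAlong (id : X → X) Z z z := by
    filter_upwards [(trivializationAt E (TangentSpace 𝓘(ℝ, E)) z).open_baseSet.mem_nhds
      (FiberBundle.mem_baseSet_trivializationAt' z)] with y hy
    simp only [coordAlong, id, Z']
    rw [extend_eq _ hy]
    exact (trivializationAt E (TangentSpace 𝓘(ℝ, E)) z).continuousLinearMapAt_symmL hy _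
  have hd : mvfderiv 𝓘(ℝ, E) (coordAlong (id : X → X) Z' z) z a = 0 := by
    have : mfderiv 𝓘(ℝ, E) 𝓘(ℝ, E)
        (coordAlong (id : X → X) Z' z) z = 0 := by
      rw [hc.mfderiv_eq]; exact mfderiv_const
    simp only [mvfderiv, this]
    rfl
  have h' : A Z = D Z' z a - (trivializationAt E (TangentSpace 𝓘(ℝ, E)) z).symmL ℝ z
      (mvfderiv 𝓘(ℝ, E) (coordAlong (id : X → X) Z' z) z a) := h
  rw [hd, map_zero, sub_zero] at h'
  rw [← h']
  simp only [A]
  abel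

/-- The chain rule: `∇_u (Z ∘ i) = (∇_{di(u)} Z) ∘ i`. -/
theorem covAlong_comp [FiniteDimensional ℝ E] {Z : ∀ z : X, TangentSpace 𝓘(ℝ, E) z}
    (hZ : MDifferentiableAt 𝓘(ℝ, E) (𝓘(ℝ, E).prod 𝓘(ℝ, E))
      (fun y => (TotalSpace.mk' E y (Z y) : TangentBundle 𝓘(ℝ, E) X)) (i x))
    (hi : MDifferentiableAt 𝓘(ℝ, E') 𝓘(ℝ, E) i x) (u : TangentSpace 𝓘(ℝ, E') x) :
    covAlong D i (fun y => Z (i y)) x u = D Z (i x) (mfderiv 𝓘(ℝ, E') 𝓘(ℝ, E) i x u) := by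
  have hZ' : MDiffAlongAt E (id : X → X) Z (i x) := hZ
  have h : mvfderiv 𝓘(ℝ, E') (coordAlong i (fun y => Z (i y)) x) x u
      = mvfderiv 𝓘(ℝ, E) (coordAlong (id : X → X) Z (i x)) (i x)
        (mfderiv 𝓘(ℝ, E') 𝓘(ℝ, E) i x u) :=
    mfderiv_comp_apply x hZ'.coord hi u
  rw [connection_eq_coord D hZ, covAlong_eq, h]

theorem MDiffAlongAt.sum {ι : Type*} {s : Finset ι} {F : ι → ∀ x : M, TangentSpace 𝓘(ℝ, E) (i x)}
    (hi : MDifferentiableAt 𝓘(ℝ, E') 𝓘(ℝ, E) i x) (hF : ∀ a ∈ s, MDiffAlongAt E' i (F a) x) :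
    MDiffAlongAt E' i (fun y => ∑ a ∈ s, F a y) x := by
  classical
  induction s using Finset.induction_on with
  | empty =>
    simp only [Finset.sum_empty]
    exact MDifferentiableAt.comp x
      (mdifferentiableAt_zeroSection ℝ (TangentSpace 𝓘(ℝ, E) : X → Type _)) hi
  | insert a s ha ih =>
    simp only [Finset.sum_insert ha]
    exact (hF a (by simp)).add (ih fun b hb => hF b (by simp [hb]))

/-- Every differentiable section of `TX|_M` is locally a combination, with functions on `M` as
coefficients, of restrictions to `M` of vector fields of `X`. -/
@[elab_as_elim]
theorem MDiffAlongAt.induction [FiniteDimensional ℝ E]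
    {P : (∀ x : M, TangentSpace 𝓘(ℝ, E) (i x)) → Prop}
    (congr : ∀ V W, MDiffAlongAt E' i V x → V =ᶠ[𝓝 x] W → P V → P W)
    (add : ∀ V W, MDiffAlongAt E' i V x → MDiffAlongAt E' i W x → P V → P W →
      P fun y => V y + W y)
    (smul : ∀ (f : M → ℝ) V, MDifferentiableAt 𝓘(ℝ, E') 𝓘(ℝ, ℝ) f x → MDiffAlongAt E' i V x →
      P V → P fun y => f y • V y)
    (comp : ∀ Z : ∀ z : X, TangentSpace 𝓘(ℝ, E) z,
      MDifferentiableAt 𝓘(ℝ, E) (𝓘(ℝ, E).prod 𝓘(ℝ, E))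
        (fun y => (TotalSpace.mk' E y (Z y) : TangentBundle 𝓘(ℝ, E) X)) (i x) →
      P fun y => Z (i y))
    (hV : MDiffAlongAt E' i V x) : P V := by
  have hi := hV.base
  let e := trivializationAt E (TangentSpace 𝓘(ℝ, E) : X → Type _) (i x)
  let b := Module.finBasis ℝ E
  let Z := fun a => (FiberBundle.extend E (e.symmL ℝ (i x) (b a)) : ∀ z : X, TangentSpace 𝓘(ℝ, E) z)
  have hx : i x ∈ e.baseSet := FiberBundle.mem_baseSet_trivializationAt' (i x)
  have hZ : ∀ a, MDifferentiableAt 𝓘(ℝ, E) (𝓘(ℝ, E).prod 𝓘(ℝ, E))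
      (fun y => (TotalSpace.mk' E y (Z a y) : TangentBundle 𝓘(ℝ, E) X)) (i x) :=
    fun a => FiberBundle.mdifferentiableAt_extend ..
  let f := fun a y => b.coord a (coordAlong i V x y)
  have hf : ∀ a, MDifferentiableAt 𝓘(ℝ, E') 𝓘(ℝ, ℝ) (f a) x := fun a =>
    ((b.coord a).toContinuousLinearMap.differentiable.mdifferentiable _).comp x hV.coord
  have hfZ : ∀ a, MDiffAlongAt E' i (fun y => f a y • Z a (i y)) x := fun a =>
    ((MDiffAlongAt.comp (hZ a) hi)).smul (hf a)
  have key : (fun y => ∑ a, f a y • Z a (i y)) =ᶠ[𝓝 x] V := by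
    filter_upwards [hi.continuousAt (e.open_baseSet.mem_nhds hx)] with y hy
    have h1 : ∀ a, Z a (i y) = e.symmL ℝ (i y) (b a) := fun a => by
      simp only [Z]
      rw [extend_eq _ hy]
      exact congrArg _ (e.continuousLinearMapAt_symmL hx _)
    have h2 : e.symmL ℝ (i y) (coordAlong i V x y) = V y := e.symmL_continuousLinearMapAt hy _
    have h3 : e.symmL ℝ (i y) (∑ a, f a y • b a) = ∑ a, f a y • e.symmL ℝ (i y) (b a) := by
      rw [map_sum]
      exact Finset.sum_congr rfl fun a _ => map_smul _ _ _
    simp only [h1]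
    rw [← h2, ← b.sum_repr (coordAlong i V x y)]
    exact h3.symm
  refine congr _ _ (MDiffAlongAt.sum hi fun a _ => hfZ a) key ?_
  have : ∀ s : Finset (Fin (Module.finrank ℝ E)), P fun y => ∑ a ∈ s, f a y • Z a (i y) := by
    classical
    intro s
    induction s using Finset.induction_on with
    | empty =>
      simpa using comp 0 (mdifferentiableAt_zeroSection ℝ (TangentSpace 𝓘(ℝ, E) : X → Type _))
    | insert a s ha ih =>
      simp only [Finset.sum_insert ha]
      exact add _ _ (hfZ a) (MDiffAlongAt.sum hi fun b _ => hfZ b)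
        (smul _ _ (hf a) (MDiffAlongAt.comp (hZ a) hi) (comp _ (hZ a))) ih
  exact this _

end Along

/-! ### Compatibility of the induced connection with the metric and with `J` -/

section Along

variable {E : Type*} [NormedAddCommGroup E] [NormedSpace ℝ E] [FiniteDimensional ℝ E]
  {X : Type*} [TopologicalSpace X] [ChartedSpace E X] [IsManifold 𝓘(ℝ, E) ∞ X]
  {E' : Type*} [NormedAddCommGroup E'] [NormedSpace ℝ E']
  {M : Type*} [TopologicalSpace M] [ChartedSpace E' M]
  {i : M → X} {V W : ∀ x : M, TangentSpace 𝓘(ℝ, E) (i x)} {x : M}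
  {g : SemiRiemannianMetric E X} {nabla : AffineConnection E X}

omit [FiniteDimensional ℝ E] in
theorem MDiffAlongAt.metric (g : SemiRiemannianMetric E X) (hV : MDiffAlongAt E' i V x)
    (hW : MDiffAlongAt E' i W x) :
    MDifferentiableAt 𝓘(ℝ, E') 𝓘(ℝ, ℝ) (fun y => g.val (i y) (V y) (W y)) x := by
  have : MDifferentiableAt 𝓘(ℝ, E') (𝓘(ℝ, E).prod 𝓘(ℝ, ℝ))
      (fun y => TotalSpace.mk' ℝ (E := Bundle.Trivial X ℝ) (i y) (g.val (i y) (V y) (W y))) x := by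
    apply MDifferentiableAt.clm_bundle_apply₂ (F₁ := E) (F₂ := E)
    · exact MDifferentiableAt.comp x (g.contMDiff.contMDiffAt.mdifferentiableAt (by simp)) hV.base
    · exact hV
    · exact hW
  simp only [mdifferentiableAt_totalSpace] at this
  exact this.2

omit [FiniteDimensional ℝ E] in
theorem MDiffAlongAt.apply {p q : ℕ} (J : MetallicStructure g p q) (hV : MDiffAlongAt E' i V x) :
    MDiffAlongAt E' i (fun y => J.toFun (i y) (V y)) x := by
  have h := MDifferentiableAt.comp x
    ((J.contMDiff.contMDiffAt (x := i x)).mdifferentiableAt (by simp)) hV.base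
  exact MDifferentiableAt.clm_bundle_apply h hV

/-- Metric compatibility of the connection induced on `TX|_M`. -/
theorem IsLeviCivita.metric_along (hn : IsLeviCivita g nabla) (hV : MDiffAlongAt E' i V x)
    (hW : MDiffAlongAt E' i W x) (u : TangentSpace 𝓘(ℝ, E') x) :
    mvfderiv 𝓘(ℝ, E') (fun y => g.val (i y) (V y) (W y)) x u
      = g.val (i x) (covAlong nabla i V x u) (W x)
        + g.val (i x) (V x) (covAlong nabla i W x u) := by
  refine hV.induction ?_ ?_ ?_ ?_
  · intro V V' hV h ih
    have : (fun y => g.val (i y) (V y) (W y)) =ᶠ[𝓝 x] fun y => g.val (i y) (V' y) (W y) :=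
      h.mono fun y hy => by simp only [hy]
    rw [← covAlong_congr nabla h, ← h.eq_of_nhds, ← ih]
    simp only [mvfderiv, this.mfderiv_eq]
    rfl
  · intro V V' hV hV' ih ih'
    rw [covAlong_add nabla hV hV']
    simp only [map_add, add_apply]
    have := mvfderiv_add (hV.metric g hW) (hV'.metric g hW)
    erw [congr($this u)]
    rw [add_apply, ih, ih']
    ring
  · intro f V hf hV ih
    rw [covAlong_smul nabla hf hV]
    simp only [map_smul, map_add, add_apply, smul_apply]
    have := mvfderiv_mul hf (hV.metric g hW)
    erw [congr($this u)]
    rw [add_apply, smul_apply, smul_apply, ih]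
    simp only [smul_eq_mul]
    ring
  · intro Z hZ
    refine hW.induction ?_ ?_ ?_ ?_
    · intro W W' hW h ih
      have : (fun y => g.val (i y) (Z (i y)) (W y)) =ᶠ[𝓝 x]
          fun y => g.val (i y) (Z (i y)) (W' y) :=
        h.mono fun y hy => by simp only [hy]
      rw [← covAlong_congr nabla h, ← h.eq_of_nhds, ← ih]
      simp only [mvfderiv, this.mfderiv_eq]
      rfl
    · intro W W' hW' hW'' ih ih'
      have hZ' := MDiffAlongAt.comp hZ hV.base
      rw [covAlong_add nabla hW' hW'']
      simp only [map_add]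
      have := mvfderiv_add (hZ'.metric g hW') (hZ'.metric g hW'')
      erw [congr($this u)]
      rw [add_apply, ih, ih']
      ring
    · intro f W hf hW ih
      have hZ' := MDiffAlongAt.comp hZ hV.base
      rw [covAlong_smul nabla hf hW]
      simp only [map_smul, map_add]
      have := mvfderiv_mul hf (hZ'.metric g hW)
      erw [congr($this u)]
      rw [add_apply, smul_apply, smul_apply, ih]
      simp only [smul_eq_mul]
      ring
    · intro Y hY
      rw [covAlong_comp nabla hZ hV.base, covAlong_comp nabla hY hV.base, ← hn.metric Z Y _ _ hZ hY]
      have hd : MDifferentiableAt 𝓘(ℝ, E) 𝓘(ℝ, ℝ) (fun z => g.val z (Z z) (Y z)) (i x) :=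
        MDiffAlongAt.metric (i := (id : X → X)) (E' := E) g hZ hY
      exact mvfderiv_comp_apply x hd hV.base u

/-- If `J` is parallel along `M`, then `∇_u (J V) = J (∇_u V)` for each section `V` of `TX|_M`
which is tangent to `M` at the point under consideration. -/
theorem IsParallelAlong.covAlong_apply {p q : ℕ} {J : MetallicStructure g p q}
    (hJ : IsParallelAlong (E' := E') J nabla i) (hV : MDiffAlongAt E' i V x)
    (hVx : V x ∈ tangentImage (E' := E') i x) (u : TangentSpace 𝓘(ℝ, E') x) :
    covAlong nabla i (fun y => J.toFun (i y) (V y)) x u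
      = J.toFun (i x) (covAlong nabla i V x u) := by
  let a := mfderiv 𝓘(ℝ, E') 𝓘(ℝ, E) i x u
  -- `(∇_a J) Z` is tensorial in `Z`
  let A : (∀ z : X, TangentSpace 𝓘(ℝ, E) z) → TangentSpace 𝓘(ℝ, E) (i x) := fun Z =>
    nabla (fun z => J.toFun z (Z z)) (i x) a - J.toFun (i x) (nabla Z (i x) a)
  have hJd : ∀ Z : ∀ z : X, TangentSpace 𝓘(ℝ, E) z,
      MDifferentiableAt 𝓘(ℝ, E) (𝓘(ℝ, E).prod 𝓘(ℝ, E))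
        (fun y => (TotalSpace.mk' E y (Z y) : TangentBundle 𝓘(ℝ, E) X)) (i x) →
      MDifferentiableAt 𝓘(ℝ, E) (𝓘(ℝ, E).prod 𝓘(ℝ, E))
        (fun y => (TotalSpace.mk' E y (J.toFun y (Z y)) : TangentBundle 𝓘(ℝ, E) X)) (i x) :=
    fun Z hZ => MDiffAlongAt.apply (i := (id : X → X)) (E' := E) J hZ
  have hA : TensorialAt 𝓘(ℝ, E) E A (i x) := by
    constructor
    · intro f Z hf hZ
      have h : (fun z => J.toFun z ((f • Z) z)) = f • fun z => J.toFun z (Z z) := by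
        ext z; exact map_smul _ _ _
      simp only [A]
      rw [h, nabla.isCovariantDerivativeOn.leibniz (hJd Z hZ) hf,
        nabla.isCovariantDerivativeOn.leibniz hZ hf]
      simp only [add_apply, smul_apply, ContinuousLinearMap.smulRight_apply, map_add, map_smul]
      module
    · intro Z Z' hZ hZ'
      have h : (fun z => J.toFun z ((Z + Z') z))
          = (fun z => J.toFun z (Z z)) + fun z => J.toFun z (Z' z) := by
        ext z; exact map_add _ _ _
      simp only [A]
      rw [h, nabla.isCovariantDerivativeOn.add (hJd Z hZ) (hJd Z' hZ'),
        nabla.isCovariantDerivativeOn.add hZ hZ']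
      simp only [add_apply, map_add]
      abel
  let T := TensorialAt.mkHom A (i x) hA
  have key : covAlong nabla i (fun y => J.toFun (i y) (V y)) x u
      - J.toFun (i x) (covAlong nabla i V x u) = T (V x) := by
    refine hV.induction ?_ ?_ ?_ ?_
    · intro V V' hV h ih
      have : (fun y => J.toFun (i y) (V y)) =ᶠ[𝓝 x] fun y => J.toFun (i y) (V' y) :=
        h.mono fun y hy => by simp only [hy]; rfl
      rw [← covAlong_congr nabla h, ← h.eq_of_nhds, ← covAlong_congr nabla this, ih]
    · intro V V' hV hV' ih ih'
      simp only [map_add]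
      rw [covAlong_add nabla hV hV', covAlong_add nabla (hV.apply J) (hV'.apply J), ← ih, ← ih',
        map_add]
      abel
    · intro f V hf hV ih
      simp only [map_smul]
      rw [covAlong_smul nabla hf hV, covAlong_smul nabla hf (hV.apply J), ← ih, map_add, map_smul,
        map_smul]
      module
    · intro Z hZ
      rw [TensorialAt.mkHom_apply hA hZ, covAlong_comp nabla hZ hV.base,
        covAlong_comp nabla (hJd Z hZ) hV.base]
  have h0 : T (V x) = 0 := by
    have h := hJ x u (FiberBundle.extend E (V x)) (FiberBundle.mdifferentiableAt_extend ..)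
      (by rwa [FiberBundle.extend_apply_self])
    exact sub_eq_zero.2 h
  rw [h0] at key
  exact sub_eq_zero.1 key

end Along

/-! ### The torsion formula along a map -/

section TorsionAlong

variable {E : Type*} [NormedAddCommGroup E] [NormedSpace ℝ E] [FiniteDimensional ℝ E]
  {X : Type*} [TopologicalSpace X] [ChartedSpace E X] [IsManifold 𝓘(ℝ, E) ∞ X]
  {E' : Type*} [NormedAddCommGroup E'] [NormedSpace ℝ E'] [FiniteDimensional ℝ E']
  {M : Type*} [TopologicalSpace M] [ChartedSpace E' M] [IsManifold 𝓘(ℝ, E') ∞ M]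
  {i : M → X} {x : M}
  {g : SemiRiemannianMetric E X} {nabla : AffineConnection E X}

/-- The section `di(V)` of `TX|_M` defined by a vector field `V` on `M`. -/
def push (i : M → X) (V : ∀ x : M, TangentSpace 𝓘(ℝ, E') x) (x : M) :
    TangentSpace 𝓘(ℝ, E) (i x) := mfderiv 𝓘(ℝ, E') 𝓘(ℝ, E) i x (V x)

omit [FiniteDimensional ℝ E] [FiniteDimensional ℝ E'] [IsManifold 𝓘(ℝ, E') ∞ M] in
/-- In coordinates, `di(V)` is the derivative along `V` of the coordinate expression of `i`. -/
theorem coordAlong_push_eventuallyEq (hi : ContMDiff 𝓘(ℝ, E') 𝓘(ℝ, E) ∞ i)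
    (V : ∀ x : M, TangentSpace 𝓘(ℝ, E') x) :
    coordAlong i (push (E := E) i V) x =ᶠ[𝓝 x]
      fun y => mvfderiv 𝓘(ℝ, E') (extChartAt 𝓘(ℝ, E) (i x) ∘ i) y (V y) := by
  filter_upwards [hi.continuous.continuousAt (chart_source_mem_nhds E (i x))] with y hy
  have hc := mfderiv_comp_apply y (mdifferentiableAt_extChartAt (I := 𝓘(ℝ, E)) hy)
    (hi.mdifferentiable (by simp) y) (V y)
  simp only [coordAlong]
  rw [TangentBundle.continuousLinearMapAt_trivializationAt hy]
  exact hc.symm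

omit [FiniteDimensional ℝ E] [FiniteDimensional ℝ E'] in
theorem mdiffAlongAt_push (hi : ContMDiff 𝓘(ℝ, E') 𝓘(ℝ, E) ∞ i)
    {V : ∀ x : M, TangentSpace 𝓘(ℝ, E') x}
    (hV : MDifferentiableAt 𝓘(ℝ, E') (𝓘(ℝ, E').prod 𝓘(ℝ, E'))
      (fun y => (TotalSpace.mk' E' y (V y) : TangentBundle 𝓘(ℝ, E') M)) x) :
    MDiffAlongAt E' i (push (E := E) i V) x := by
  have h := (hi.contMDiff_tangentMap (m := 1) (by norm_num; exact ENat.LEInfty.out))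
  exact MDifferentiableAt.comp x (h.mdifferentiable (by simp) _) hV

omit [FiniteDimensional ℝ E] [FiniteDimensional ℝ E'] [IsManifold 𝓘(ℝ, E') ∞ M] in
theorem mvfderiv_eq_zero_of_eventuallyEq_const {f : M → E} {c : E} (h : f =ᶠ[𝓝 x] fun _ => c)
    (u : TangentSpace 𝓘(ℝ, E') x) : mvfderiv 𝓘(ℝ, E') f x u = 0 := by
  simp only [mvfderiv, h.mfderiv_eq]
  rw [mfderiv_const]
  rfl

/-- The Christoffel symbols of a torsion-free connection are symmetric. -/
theorem IsLeviCivita.christoffel_symm (hn : IsLeviCivita g nabla) (z : X)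
    (a b : TangentSpace 𝓘(ℝ, E) z) :
    nabla (FiberBundle.extend E b) z a = nabla (FiberBundle.extend E a) z b := by
  have hd := fun v : TangentSpace 𝓘(ℝ, E) z =>
    FiberBundle.mdifferentiableAt_extend 𝓘(ℝ, E) E v
  have ht := hn.torsion_free _ _ z (hd a) (hd b)
  rw [FiberBundle.extend_apply_self, FiberBundle.extend_apply_self] at ht
  rw [← sub_eq_zero, ht]
  have hφ : ContMDiffAt 𝓘(ℝ, E) 𝓘(ℝ, E) ∞ (extChartAt 𝓘(ℝ, E) z) z := contMDiffAt_extChartAt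
  have h := mvfderiv_mlieBracket hφ (hd a) (hd b)
  have hconst : ∀ (v : TangentSpace 𝓘(ℝ, E) z) (w : E), mvfderiv 𝓘(ℝ, E) (fun y =>
      mvfderiv 𝓘(ℝ, E) (extChartAt 𝓘(ℝ, E) z) y
        ((FiberBundle.extend E v : ∀ y : X, TangentSpace 𝓘(ℝ, E) y) y)) z w = 0 := by
    intro v w
    have : (fun y => mvfderiv 𝓘(ℝ, E) (extChartAt 𝓘(ℝ, E) z) y
        ((FiberBundle.extend E v : ∀ y : X, TangentSpace 𝓘(ℝ, E) y) y)) =ᶠ[𝓝 z]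
        fun _ => (trivializationAt E (TangentSpace 𝓘(ℝ, E)) z).continuousLinearMapAt ℝ z v := by
      filter_upwards [chart_source_mem_nhds E z] with y hy
      rw [extend_eq v hy]
      have h1 := (trivializationAt E (TangentSpace 𝓘(ℝ, E)) z).continuousLinearMapAt_symmL
        (R := ℝ) (b := y) hy
        ((trivializationAt E (TangentSpace 𝓘(ℝ, E)) z).continuousLinearMapAt ℝ z v)
      rw [TangentBundle.continuousLinearMapAt_trivializationAt hy] at h1
      exact h1
    exact mvfderiv_eq_zero_of_eventuallyEq_const this w
  erw [hconst, hconst, sub_zero] at h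
  have h2 : mvfderiv 𝓘(ℝ, E) (extChartAt 𝓘(ℝ, E) z) z = ContinuousLinearMap.id ℝ E :=
    mfderiv_extChartAt_self
  rw [h2] at h
  exact h.symm

/-- The torsion formula along `i`: `∇_U di(V) - ∇_V di(U) = di([U, V])`. -/
theorem IsLeviCivita.torsion_along (hn : IsLeviCivita g nabla)
    (hi : ContMDiff 𝓘(ℝ, E') 𝓘(ℝ, E) ∞ i) {U V : ∀ x : M, TangentSpace 𝓘(ℝ, E') x}
    (hU : MDifferentiableAt 𝓘(ℝ, E') (𝓘(ℝ, E').prod 𝓘(ℝ, E'))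
      (fun y => (TotalSpace.mk' E' y (U y) : TangentBundle 𝓘(ℝ, E') M)) x)
    (hV : MDifferentiableAt 𝓘(ℝ, E') (𝓘(ℝ, E').prod 𝓘(ℝ, E'))
      (fun y => (TotalSpace.mk' E' y (V y) : TangentBundle 𝓘(ℝ, E') M)) x) :
    covAlong nabla i (push i V) x (U x) - covAlong nabla i (push i U) x (V x)
      = push i (VectorField.mlieBracket 𝓘(ℝ, E') U V) x := by
  let φ : M → E := extChartAt 𝓘(ℝ, E) (i x) ∘ i
  have hφ : ContMDiffAt 𝓘(ℝ, E') 𝓘(ℝ, E) ∞ φ x :=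
    ContMDiffAt.comp x contMDiffAt_extChartAt hi.contMDiffAt
  have hd : ∀ (V : ∀ x : M, TangentSpace 𝓘(ℝ, E') x) (u : TangentSpace 𝓘(ℝ, E') x),
      mvfderiv 𝓘(ℝ, E') (coordAlong i (push (E := E) i V) x) x u
        = mvfderiv 𝓘(ℝ, E') (fun y => mvfderiv 𝓘(ℝ, E') φ y (V y)) x u := by
    intro V u
    simp only [mvfderiv, (coordAlong_push_eventuallyEq hi V).mfderiv_eq]
    rfl
  have h := mvfderiv_mlieBracket hφ hU hV
  have hb := (coordAlong_push_eventuallyEq (x := x) hi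
    (VectorField.mlieBracket 𝓘(ℝ, E') U V)).eq_of_nhds
  have hc : nabla (FiberBundle.extend E (push i V x)) (i x) (mfderiv 𝓘(ℝ, E') 𝓘(ℝ, E) i x (U x))
      = nabla (FiberBundle.extend E (push i U x)) (i x) (mfderiv 𝓘(ℝ, E') 𝓘(ℝ, E) i x (V x)) :=
    hn.christoffel_symm (i x) _ _
  -- the Christoffel terms cancel, and the derivatives of components give the bracket
  rw [covAlong_eq, covAlong_eq, hd, hd, hc,
    add_sub_add_comm, ← map_sub]
  erw [h]
  rw [← hb, symmL_coordAlong]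
  exact add_eq_left.2 (sub_self _)

end TorsionAlong

/-! ### Smoothness of lifts, and extension of vectors to sections -/

section Lift

variable {E : Type*} [NormedAddCommGroup E] [NormedSpace ℝ E]
  {X : Type*} [TopologicalSpace X] [ChartedSpace E X] [IsManifold 𝓘(ℝ, E) ∞ X]
  {E' : Type*} [NormedAddCommGroup E'] [NormedSpace ℝ E']
  {M : Type*} [TopologicalSpace M] [ChartedSpace E' M]
  {i : M → X} {V W : ∀ x : M, TangentSpace 𝓘(ℝ, E) (i x)} {x : M}

/-- Smoothness at `x` of the section `V` of `TX|_M`. -/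
def SmoothAlongAt (E' : Type*) [NormedAddCommGroup E'] [NormedSpace ℝ E']
    {M : Type*} [TopologicalSpace M] [ChartedSpace E' M] (i : M → X)
    (V : ∀ x : M, TangentSpace 𝓘(ℝ, E) (i x)) (x : M) : Prop :=
  ContMDiffAt 𝓘(ℝ, E') (𝓘(ℝ, E).prod 𝓘(ℝ, E)) ∞
    (fun y => (TotalSpace.mk' E (i y) (V y) : TangentBundle 𝓘(ℝ, E) X)) x

theorem smoothAlongAt_iff :
    SmoothAlongAt E' i V x ↔ ContMDiffAt 𝓘(ℝ, E') 𝓘(ℝ, E) ∞ i x ∧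
      ContMDiffAt 𝓘(ℝ, E') 𝓘(ℝ, E) ∞ (coordAlong i V x) x := by
  rw [SmoothAlongAt, contMDiffAt_totalSpace]
  refine and_congr_right fun hi => ?_
  exact (coordAlong_eventuallyEq (V := V) hi.continuousAt).contMDiffAt_iff.symm

theorem SmoothAlongAt.congr (h : V =ᶠ[𝓝 x] W) (hV : SmoothAlongAt E' i V x) :
    SmoothAlongAt E' i W x :=
  ContMDiffAt.congr_of_eventuallyEq hV (h.symm.mono fun y hy => by simp only [hy])

theorem SmoothAlongAt.smul {f : M → ℝ} (hf : ContMDiffAt 𝓘(ℝ, E') 𝓘(ℝ, ℝ) ∞ f x)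
    (hV : SmoothAlongAt E' i V x) : SmoothAlongAt E' i (fun y => f y • V y) x := by
  rw [smoothAlongAt_iff] at hV ⊢
  rw [coordAlong_smul]
  exact ⟨hV.1, hf.smul hV.2⟩

theorem SmoothAlongAt.sum {ι : Type*} {s : Finset ι} {F : ι → ∀ x : M, TangentSpace 𝓘(ℝ, E) (i x)}
    (hi : ContMDiffAt 𝓘(ℝ, E') 𝓘(ℝ, E) ∞ i x) (hF : ∀ a ∈ s, SmoothAlongAt E' i (F a) x) :
    SmoothAlongAt E' i (fun y => ∑ a ∈ s, F a y) x := by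
  have h : coordAlong i (fun y => ∑ a ∈ s, F a y) x = fun y => ∑ a ∈ s, coordAlong i (F a) x y := by
    ext y; exact map_sum _ _ _
  rw [smoothAlongAt_iff, h]
  exact ⟨hi, ContMDiffAt.sum fun a ha => (smoothAlongAt_iff.1 (hF a ha)).2⟩

theorem SmoothAlongAt.zero (hi : ContMDiffAt 𝓘(ℝ, E') 𝓘(ℝ, E) ∞ i x) :
    SmoothAlongAt E' i (fun y => (0 : TangentSpace 𝓘(ℝ, E) (i y))) x := by
  have h : coordAlong i (fun y => (0 : TangentSpace 𝓘(ℝ, E) (i y))) x = fun _ => 0 := by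
    ext y; exact map_zero _
  rw [smoothAlongAt_iff, h]
  exact ⟨hi, contMDiffAt_const⟩

theorem SmoothAlongAt.apply {g : SemiRiemannianMetric E X} {p q : ℕ} (J : MetallicStructure g p q)
    (hV : SmoothAlongAt E' i V x) : SmoothAlongAt E' i (fun y => J.toFun (i y) (V y)) x := by
  have h := ContMDiffAt.comp x (J.contMDiff.contMDiffAt (x := i x)) (smoothAlongAt_iff.1 hV).1
  exact ContMDiffAt.clm_bundle_apply h hV

variable [FiniteDimensional ℝ E] [FiniteDimensional ℝ E'] [IsManifold 𝓘(ℝ, E') ∞ M]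

omit [FiniteDimensional ℝ E] [FiniteDimensional ℝ E'] in
theorem smoothAlongAt_push (hi : ContMDiff 𝓘(ℝ, E') 𝓘(ℝ, E) ∞ i)
    {U : ∀ x : M, TangentSpace 𝓘(ℝ, E') x} (hU : IsSmoothField E' M U) :
    SmoothAlongAt E' i (push (E := E) i U) x := by
  have h := (hi.contMDiff_tangentMap (m := ∞) (by simp))
  exact ContMDiffAt.comp x (h.contMDiffAt) hU.contMDiffAt

/-- A vector field on `M` is smooth if its image under the immersion `i` is a smooth section of
`TX|_M`. -/
theorem SmoothAlongAt.contMDiffAt_of_push (hinj : Function.Injective (mfderiv 𝓘(ℝ, E') 𝓘(ℝ, E) i x))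
    {U : ∀ x : M, TangentSpace 𝓘(ℝ, E') x} (hU : SmoothAlongAt E' i (push (E := E) i U) x) :
    ContMDiffAt 𝓘(ℝ, E') (𝓘(ℝ, E').prod 𝓘(ℝ, E')) ∞
      (fun y => (TotalSpace.mk' E' y (U y) : TangentBundle 𝓘(ℝ, E') M)) x := by
  have : CompleteSpace E' := FiniteDimensional.complete ℝ E'
  obtain ⟨hi, hs⟩ := smoothAlongAt_iff.1 hU
  refine smoothAlongAt_iff.2 ⟨contMDiffAt_id, ?_⟩
  let e := trivializationAt E (TangentSpace 𝓘(ℝ, E) : X → Type _) (i x)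
  let e' := trivializationAt E' (TangentSpace 𝓘(ℝ, E') : M → Type _) x
  have hx : i x ∈ e.baseSet := FiberBundle.mem_baseSet_trivializationAt' (i x)
  have hx' : x ∈ e'.baseSet := FiberBundle.mem_baseSet_trivializationAt' x
  -- the differential of `i` in coordinates
  let A : M → E' →L[ℝ] E :=
    inTangentCoordinates 𝓘(ℝ, E') 𝓘(ℝ, E) id i (mfderiv 𝓘(ℝ, E') 𝓘(ℝ, E) i) x
  have hA : ContMDiffAt 𝓘(ℝ, E') 𝓘(ℝ, E' →L[ℝ] E) ∞ A x := hi.mfderiv_const (by simp)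
  have hAapp : ∀ y a, A y a = e.continuousLinearMapAt ℝ (i y)
      (mfderiv 𝓘(ℝ, E') 𝓘(ℝ, E) i y (e'.symmL ℝ y a)) := fun y a => rfl
  have hAinj : Function.Injective (A x) := by
    intro a b hab
    rw [hAapp, hAapp] at hab
    have h1 := congrArg (e.symmL ℝ (i x)) hab
    rw [e.symmL_continuousLinearMapAt hx, e.symmL_continuousLinearMapAt hx] at h1
    have h2 := congrArg (e'.continuousLinearMapAt ℝ x) (hinj h1)
    rwa [e'.continuousLinearMapAt_symmL hx', e'.continuousLinearMapAt_symmL hx'] at h2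
  -- a left inverse `P` of `A x`; near `x` the field `U` has the components `(P A)⁻¹ P s`, where
  -- `s` are the components of `di(U)`
  obtain ⟨P₀, hP₀⟩ := (A x).toLinearMap.exists_leftInverse_of_injective
    (LinearMap.ker_eq_bot.2 hAinj)
  let P : E →L[ℝ] E' := LinearMap.toContinuousLinearMap P₀
  have hP : P.comp (A x) = (ContinuousLinearEquiv.refl ℝ E' : E' →L[ℝ] E') := by
    ext a; exact congr($hP₀ a)
  have hPA : ContMDiffAt 𝓘(ℝ, E') 𝓘(ℝ, E' →L[ℝ] E') ∞ (fun y => P.comp (A y)) x :=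
    contMDiffAt_const.clm_comp hA
  have hinv : ContMDiffAt 𝓘(ℝ, E') 𝓘(ℝ, E' →L[ℝ] E') ∞ (fun y => (P.comp (A y)).inverse) x := by
    refine ContMDiffAt.comp (g := ContinuousLinearMap.inverse) x ?_ hPA
    rw [hP]
    exact (contDiffAt_map_inverse _).contMDiffAt
  have hfin : ContMDiffAt 𝓘(ℝ, E') 𝓘(ℝ, E') ∞
      (fun y => (P.comp (A y)).inverse (P (coordAlong i (push i U) x y))) x :=
    hinv.clm_apply (contMDiffAt_const.clm_apply hs)
  refine hfin.congr_of_eventuallyEq ?_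
  have hnhds : ∀ᶠ y in 𝓝 x, P.comp (A y) ∈ range ((↑) : (E' ≃L[ℝ] E') → E' →L[ℝ] E') :=
    hPA.continuousAt.eventually_mem (by rw [hP]; exact ContinuousLinearEquiv.nhds _)
  filter_upwards [hnhds, e'.open_baseSet.mem_nhds hx'] with y hy hy'
  obtain ⟨c, hc⟩ := hy
  have h1 : A y (e'.continuousLinearMapAt ℝ y (U y)) = coordAlong i (push i U) x y := by
    rw [hAapp, e'.symmL_continuousLinearMapAt hy']; rfl
  have h2 : c (e'.continuousLinearMapAt ℝ y (U y)) = P (coordAlong i (push i U) x y) := by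
    rw [← h1]; exact congr($hc _)
  rw [← hc, ContinuousLinearMap.inverse_equiv, ← h2]
  exact (c.symm_apply_apply _).symm

/-- A smooth section of `TX|_M` tangent to `M` comes from a smooth vector field on `M`. -/
theorem exists_lift
    (hinj : ∀ x, Function.Injective (mfderiv 𝓘(ℝ, E') 𝓘(ℝ, E) i x))
    (hV : ∀ x, SmoothAlongAt E' i V x) (hVt : ∀ x, V x ∈ tangentImage (E' := E') i x) :
    ∃ U : ∀ x : M, TangentSpace 𝓘(ℝ, E') x, IsSmoothField E' M U ∧ push i U = V := by
  choose U hU using hVt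
  have h : push i U = V := funext hU
  exact ⟨U, fun x => (h ▸ hV x).contMDiffAt_of_push (hinj x), h⟩

/-- Every vector of a smooth distribution on `M` extends to a global section of it. -/
theorem exists_isSectionOf [T2Space M] (hi : ContMDiff 𝓘(ℝ, E') 𝓘(ℝ, E) ∞ i)
    (hinj : ∀ x, Function.Injective (mfderiv 𝓘(ℝ, E') 𝓘(ℝ, E) i x))
    {F : ∀ x : M, Submodule ℝ (TangentSpace 𝓘(ℝ, E) (i x))} (hF : IsSmoothSubbundle (E' := E') i F)
    (hFt : ∀ x, F x ≤ tangentImage (E' := E') i x) {v : TangentSpace 𝓘(ℝ, E) (i x)} (hv : v ∈ F x) :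
    ∃ U : ∀ x : M, TangentSpace 𝓘(ℝ, E') x, IsSectionOf i F U ∧ push i U x = v := by
  obtain ⟨W, hW, k, s, hs, hF'⟩ := hF x
  rw [← (hF' x (mem_of_mem_nhds hW)).2, Submodule.mem_span_range_iff_exists_fun] at hv
  obtain ⟨c, rfl⟩ := hv
  obtain ⟨f, hf⟩ : ∃ f : SmoothBumpFunction 𝓘(ℝ, E') x, tsupport f ⊆ interior W := by
    obtain ⟨f, -, hf⟩ := (SmoothBumpFunction.nhds_basis_tsupport (I := 𝓘(ℝ, E')) x).mem_iff.1
      (interior_mem_nhds.2 hW)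
    exact ⟨f, hf⟩
  -- a combination of the local frame with the prescribed value, cut off by the bump function `f`
  let V : ∀ x : M, TangentSpace 𝓘(ℝ, E) (i x) := fun y => f y • ∑ j, c j • s j y
  have hVF : ∀ y, V y ∈ F y := by
    intro y
    by_cases hy : y ∈ W
    · rw [← (hF' y hy).2]
      exact Submodule.smul_mem _ _ (Submodule.sum_mem _ fun j _ => Submodule.smul_mem _ _
        (Submodule.subset_span ⟨j, rfl⟩))
    · have : f y = 0 := image_eq_zero_of_notMem_tsupport fun h => hy (interior_subset (hf h))
      simp only [V, this, zero_smul]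
      exact zero_mem _
  have hVs : ∀ y, SmoothAlongAt E' i V y := by
    intro y
    by_cases hy : y ∈ interior W
    · refine SmoothAlongAt.smul f.contMDiff.contMDiffAt (SmoothAlongAt.sum hi.contMDiffAt ?_)
      intro j _
      refine SmoothAlongAt.smul contMDiffAt_const ?_
      exact (hs j).contMDiffAt (mem_interior_iff_mem_nhds.1 hy)
    · have h0 : ∀ᶠ z in 𝓝 y, z ∉ tsupport f :=
        (isClosed_tsupport f).isOpen_compl.mem_nhds fun h => hy (hf h)
      refine (SmoothAlongAt.zero hi.contMDiffAt).congr (h0.mono fun z hz => ?_)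
      simp only [V, image_eq_zero_of_notMem_tsupport hz, zero_smul]
      rfl
  obtain ⟨U, hU, hUV⟩ := exists_lift hinj hVs fun y => hFt y (hVF y)
  refine ⟨U, ⟨hU, fun y => ?_⟩, ?_⟩
  · have h := hVF y
    rwa [← hUV] at h
  · rw [hUV]
    simp [V]

end Lift

/-! ### The second fundamental forms -/

section SecondForm

variable {E : Type*} [NormedAddCommGroup E] [NormedSpace ℝ E]
  {X : Type*} [TopologicalSpace X] [ChartedSpace E X] [IsManifold 𝓘(ℝ, E) ∞ X]
  {E' : Type*} [NormedAddCommGroup E'] [NormedSpace ℝ E']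
  {M : Type*} [TopologicalSpace M] [ChartedSpace E' M] [IsManifold 𝓘(ℝ, E') ∞ M]
  {i : M → X} {x : M}
  {g : SemiRiemannianMetric E X} {nabla : AffineConnection E X}

/-- The second fundamental form `(u, v) ↦ g(∇_u V, ν)` of `M` in the direction `ν`, where `V` is
a vector field on `M` with value `v` at `x`; it is independent of the extension `V` if `ν` is
normal to `M`. -/
def secondForm (g : SemiRiemannianMetric E X) (nabla : AffineConnection E X) (i : M → X) {x : M}
    (ν : TangentSpace 𝓘(ℝ, E) (i x)) (u v : TangentSpace 𝓘(ℝ, E') x) : ℝ :=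
  g.val (i x) (covAlong nabla i (push i (FiberBundle.extend E' v)) x u) ν

omit [IsManifold 𝓘(ℝ, E) ∞ X] [IsManifold 𝓘(ℝ, E') ∞ M] in
theorem push_mem (V : ∀ x : M, TangentSpace 𝓘(ℝ, E') x) :
    push i V x ∈ tangentImage (E := E) (E' := E') i x := ⟨V x, rfl⟩

omit [IsManifold 𝓘(ℝ, E') ∞ M] in
theorem covAlong_add_direction (V : ∀ x : M, TangentSpace 𝓘(ℝ, E) (i x))
    (u v : TangentSpace 𝓘(ℝ, E') x) :
    covAlong nabla i V x (u + v) = covAlong nabla i V x u + covAlong nabla i V x v := by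
  rw [covAlong_eq, covAlong_eq, covAlong_eq]
  simp only [map_add]
  abel

theorem secondForm_add_left (ν : TangentSpace 𝓘(ℝ, E) (i x)) (u u' v : TangentSpace 𝓘(ℝ, E') x) :
    secondForm g nabla i ν (u + u') v
      = secondForm g nabla i ν u v + secondForm g nabla i ν u' v := by
  rw [secondForm, covAlong_add_direction, map_add, add_apply]
  rfl

variable [FiniteDimensional ℝ E] [FiniteDimensional ℝ E']

/-- Symmetry of the second fundamental form, for arbitrary vector fields `U` and `V`. -/
theorem IsLeviCivita.secondForm_eq (hn : IsLeviCivita g nabla)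
    (hi : ContMDiff 𝓘(ℝ, E') 𝓘(ℝ, E) ∞ i) {ν : TangentSpace 𝓘(ℝ, E) (i x)}
    (hν : ν ∈ g.orth (i x) (tangentImage (E' := E') i x)) {U V : ∀ x : M, TangentSpace 𝓘(ℝ, E') x}
    (hU : MDifferentiableAt 𝓘(ℝ, E') (𝓘(ℝ, E').prod 𝓘(ℝ, E'))
      (fun y => (TotalSpace.mk' E' y (U y) : TangentBundle 𝓘(ℝ, E') M)) x)
    (hV : MDifferentiableAt 𝓘(ℝ, E') (𝓘(ℝ, E').prod 𝓘(ℝ, E'))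
      (fun y => (TotalSpace.mk' E' y (V y) : TangentBundle 𝓘(ℝ, E') M)) x) :
    g.val (i x) (covAlong nabla i (push i V) x (U x)) ν
      = g.val (i x) (covAlong nabla i (push i U) x (V x)) ν := by
  have h := hn.torsion_along hi hU hV
  have h0 := hν _ (push_mem (x := x) (VectorField.mlieBracket 𝓘(ℝ, E') U V))
  rw [← h] at h0
  have h1 : g.val (i x) (covAlong nabla i (push i V) x (U x)
      - covAlong nabla i (push i U) x (V x)) ν = 0 := h0
  rw [map_sub] at h1
  exact sub_eq_zero.1 h1

theorem IsLeviCivita.secondForm_symm (hn : IsLeviCivita g nabla)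
    (hi : ContMDiff 𝓘(ℝ, E') 𝓘(ℝ, E) ∞ i) {ν : TangentSpace 𝓘(ℝ, E) (i x)}
    (hν : ν ∈ g.orth (i x) (tangentImage (E' := E') i x)) (u v : TangentSpace 𝓘(ℝ, E') x) :
    secondForm g nabla i ν u v = secondForm g nabla i ν v u := by
  have h := hn.secondForm_eq hi hν (FiberBundle.mdifferentiableAt_extend 𝓘(ℝ, E') E' u)
    (FiberBundle.mdifferentiableAt_extend 𝓘(ℝ, E') E' v)
  rwa [FiberBundle.extend_apply_self, FiberBundle.extend_apply_self] at h

/-- `g(∇_u V, ν)` depends only on the value of the vector field `V` at the point: by symmetry it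
is the derivative of an extension of `u` in the direction of that value. -/
theorem IsLeviCivita.metric_covAlong_push (hn : IsLeviCivita g nabla)
    (hi : ContMDiff 𝓘(ℝ, E') 𝓘(ℝ, E) ∞ i) {ν : TangentSpace 𝓘(ℝ, E) (i x)}
    (hν : ν ∈ g.orth (i x) (tangentImage (E' := E') i x)) {V : ∀ x : M, TangentSpace 𝓘(ℝ, E') x}
    (hV : MDifferentiableAt 𝓘(ℝ, E') (𝓘(ℝ, E').prod 𝓘(ℝ, E'))
      (fun y => (TotalSpace.mk' E' y (V y) : TangentBundle 𝓘(ℝ, E') M)) x)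
    (u : TangentSpace 𝓘(ℝ, E') x) :
    g.val (i x) (covAlong nabla i (push i V) x u) ν = secondForm g nabla i ν u (V x) := by
  have h := hn.secondForm_eq hi hν (FiberBundle.mdifferentiableAt_extend 𝓘(ℝ, E') E' u) hV
  rw [FiberBundle.extend_apply_self] at h
  rw [h, hn.secondForm_symm hi hν]
  rfl

theorem IsLeviCivita.secondForm_add_right (hn : IsLeviCivita g nabla)
    (hi : ContMDiff 𝓘(ℝ, E') 𝓘(ℝ, E) ∞ i) {ν : TangentSpace 𝓘(ℝ, E) (i x)}
    (hν : ν ∈ g.orth (i x) (tangentImage (E' := E') i x)) (u v v' : TangentSpace 𝓘(ℝ, E') x) :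
    secondForm g nabla i ν u (v + v')
      = secondForm g nabla i ν u v + secondForm g nabla i ν u v' := by
  rw [hn.secondForm_symm hi hν, secondForm_add_left, hn.secondForm_symm hi hν,
    hn.secondForm_symm hi hν v']

end SecondForm

/-! ### Algebra of screen semi-invariance -/

section Screen

variable {E : Type*} [NormedAddCommGroup E] [NormedSpace ℝ E]
  {X : Type*} [TopologicalSpace X] [ChartedSpace E X] [IsManifold 𝓘(ℝ, E) ∞ X]
  {E' : Type*} [NormedAddCommGroup E'] [NormedSpace ℝ E']
  {M : Type*} [TopologicalSpace M] [ChartedSpace E' M]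
  {i : M → X} {x : M} {p q r : ℕ}
  {g : SemiRiemannianMetric E X} {J : MetallicStructure g p q}
  {S : LightlikeSubmanifold E' g i r} {B : ∀ x : M, Submodule ℝ (TangentSpace 𝓘(ℝ, E) (i x))}

namespace LightlikeSubmanifold

theorem screen_le (S : LightlikeSubmanifold E' g i r) (x : M) :
    S.screen x ≤ tangentImage (E' := E') i x := S.screen_sup_rad x ▸ le_sup_left

theorem rad_le (S : LightlikeSubmanifold E' g i r) (x : M) :
    S.rad x ≤ tangentImage (E' := E') i x := S.screen_sup_rad x ▸ le_sup_right

theorem rad_le_orth (S : LightlikeSubmanifold E' g i r) (x : M) :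
    S.rad x ≤ g.orth (i x) (tangentImage (E' := E') i x) := S.rad_eq x ▸ inf_le_right

theorem screenTr_le_orth (S : LightlikeSubmanifold E' g i r) (x : M) :
    S.screenTr x ≤ g.orth (i x) (tangentImage (E' := E') i x) :=
  S.screenTr_sup_rad x ▸ le_sup_left

namespace IsScreenSemiInvariant

theorem B_le (hB : S.IsScreenSemiInvariant J B) (x : M) : B x ≤ tangentImage (E' := E') i x :=
  (hB.le_screen x).trans (S.screen_le x)

theorem sup_le (hB : S.IsScreenSemiInvariant J B) (x : M) :
    B x ⊔ S.rad x ≤ tangentImage (E' := E') i x := _root_.sup_le (hB.B_le x) (S.rad_le x)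

theorem apply_mem_B (hB : S.IsScreenSemiInvariant J B) {v : TangentSpace 𝓘(ℝ, E) (i x)}
    (hv : v ∈ B x) : J.toFun (i x) v ∈ B x := hB.map_B x ▸ ⟨v, hv, rfl⟩

theorem apply_mem_rad (hB : S.IsScreenSemiInvariant J B) {v : TangentSpace 𝓘(ℝ, E) (i x)}
    (hv : v ∈ S.rad x) : J.toFun (i x) v ∈ S.rad x := hB.map_rad x ▸ ⟨v, hv, rfl⟩

theorem apply_mem_screenTr (hB : S.IsScreenSemiInvariant J B) {v : TangentSpace 𝓘(ℝ, E) (i x)}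
    (hv : v ∈ S.perpInScreen B x) : J.toFun (i x) v ∈ S.screenTr x :=
  hB.map_perp x ⟨v, hv, rfl⟩

theorem apply_mem_sup (hB : S.IsScreenSemiInvariant J B) {v : TangentSpace 𝓘(ℝ, E) (i x)}
    (hv : v ∈ B x ⊔ S.rad x) : J.toFun (i x) v ∈ B x ⊔ S.rad x := by
  obtain ⟨b, hb, ρ, hρ, rfl⟩ := Submodule.mem_sup.1 hv
  rw [map_add]
  exact Submodule.add_mem_sup (hB.apply_mem_B hb) (hB.apply_mem_rad hρ)

theorem exists_decomposition (hB : S.IsScreenSemiInvariant J B) {z : TangentSpace 𝓘(ℝ, E) (i x)}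
    (hz : z ∈ tangentImage (E' := E') i x) :
    ∃ a ∈ B x ⊔ S.rad x, ∃ c ∈ S.perpInScreen B x, z = a + c := by
  rw [← S.screen_sup_rad x, ← hB.sup_perp x] at hz
  obtain ⟨s, hs, ρ, hρ, rfl⟩ := Submodule.mem_sup.1 hz
  obtain ⟨b, hb, c, hc, rfl⟩ := Submodule.mem_sup.1 hs
  exact ⟨b + ρ, Submodule.add_mem_sup hb hρ, c, hc, by abel⟩

theorem metric_apply_eq_zero (hB : S.IsScreenSemiInvariant J B)
    {a w : TangentSpace 𝓘(ℝ, E) (i x)} (ha : a ∈ B x ⊔ S.rad x) (hw : w ∈ S.perpInScreen B x) :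
    g.val (i x) (J.toFun (i x) a) (J.toFun (i x) w) = 0 :=
  S.screenTr_le_orth x (hB.apply_mem_screenTr hw) _ (hB.sup_le x (hB.apply_mem_sup ha))

/-- A tangent vector `z` with `g(J z, J w) = 0` for all `w ∈ B^⊥` lies in `B ⊥ Rad(TM)`: by
`g(J z, J w) = p g(z, J w) + q g(z, w)`, its `B^⊥`-component is orthogonal to `TM`. -/
theorem mem_sup_of_metric_apply (hB : S.IsScreenSemiInvariant J B) (hq : 0 < q)
    {z : TangentSpace 𝓘(ℝ, E) (i x)} (hz : z ∈ tangentImage (E' := E') i x)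
    (h : ∀ w ∈ S.perpInScreen B x, g.val (i x) (J.toFun (i x) z) (J.toFun (i x) w) = 0) :
    z ∈ B x ⊔ S.rad x := by
  obtain ⟨a, ha, c, hc, rfl⟩ := hB.exists_decomposition hz
  have hcT := S.screen_le x hc.1
  have h1 : ∀ w ∈ S.perpInScreen B x, g.val (i x) w c = 0 := by
    intro w hw
    have h2 := h w hw
    rw [map_add, map_add, add_apply, hB.metric_apply_eq_zero ha hw, zero_add, ← J.compatible,
      J.sq, map_add, map_smul, map_smul,
      show g.val (i x) c (J.toFun (i x) w) = 0 from
        S.screenTr_le_orth x (hB.apply_mem_screenTr hw) c hcT, smul_zero, zero_add] at h2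
    rw [g.symm]
    exact (smul_eq_zero.1 h2).resolve_left (by positivity)
  have hcr : c ∈ S.rad x := by
    rw [S.rad_eq]
    refine ⟨hcT, fun t ht => ?_⟩
    obtain ⟨a', ha', c', hc', rfl⟩ := hB.exists_decomposition ht
    obtain ⟨b, hb, ρ, hρ, rfl⟩ := Submodule.mem_sup.1 ha'
    have e1 : g.val (i x) b c = 0 := hc.2 b hb
    have e2 : g.val (i x) ρ c = 0 := by rw [g.symm]; exact S.rad_le_orth x hρ c hcT
    change g.val (i x) (b + ρ + c') c = 0
    rw [map_add, map_add, add_apply, add_apply, e1, e2, h1 c' hc', add_zero, add_zero]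
  have hc0 : c = 0 := by
    have : c ∈ S.screen x ⊓ S.rad x := ⟨hc.1, hcr⟩
    rwa [S.screen_inf_rad, Submodule.mem_bot] at this
  rwa [hc0, add_zero]

end IsScreenSemiInvariant

variable [FiniteDimensional ℝ E]

/-- The `S(TM^⊥)`-component of a tangent vector vanishes. -/
theorem projection_eq_zero (S : LightlikeSubmanifold E' g i r) {v : TangentSpace 𝓘(ℝ, E) (i x)}
    (hv : v ∈ tangentImage (E' := E') i x) :
    (S.screenTr x).projection _ (S.isCompl_screenTr x) v = 0 :=
  (Submodule.projection_apply_eq_zero_iff _).2 (Submodule.mem_sup_left hv)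

/-- A tangent vector lies in `B ⊥ Rad(TM)` if and only if `J` maps it to a vector without
`S(TM^⊥)`-component. -/
theorem IsScreenSemiInvariant.projection_apply_eq_zero_iff (hB : S.IsScreenSemiInvariant J B)
    (hq : 0 < q) {z : TangentSpace 𝓘(ℝ, E) (i x)} (hz : z ∈ tangentImage (E' := E') i x) :
    (S.screenTr x).projection _ (S.isCompl_screenTr x) (J.toFun (i x) z) = 0
      ↔ z ∈ B x ⊔ S.rad x := by
  refine ⟨fun h => ?_, fun h => S.projection_eq_zero (hB.sup_le x (hB.apply_mem_sup h))⟩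
  obtain ⟨a, ha, c, hc, rfl⟩ := hB.exists_decomposition hz
  rw [map_add, map_add, S.projection_eq_zero (hB.sup_le x (hB.apply_mem_sup ha)), zero_add,
    Submodule.projection_apply_of_mem_left _ (hB.apply_mem_screenTr hc)] at h
  -- `J` is injective since `q ≠ 0`
  have hc0 : (q : ℝ) • c = 0 := by
    have := J.sq (i x) c
    rwa [h, map_zero, smul_zero, zero_add, eq_comm] at this
  rw [(smul_eq_zero.1 hc0).resolve_left (by positivity), add_zero]
  exact ha

end LightlikeSubmanifold

end Screen

/-! ### Brackets of sections of `B ⊥ Rad(TM)` -/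

section Bracket

variable {E : Type*} [NormedAddCommGroup E] [NormedSpace ℝ E] [FiniteDimensional ℝ E]
  {X : Type*} [TopologicalSpace X] [ChartedSpace E X] [IsManifold 𝓘(ℝ, E) ∞ X]
  {E' : Type*} [NormedAddCommGroup E'] [NormedSpace ℝ E'] [FiniteDimensional ℝ E']
  {M : Type*} [TopologicalSpace M] [ChartedSpace E' M] [IsManifold 𝓘(ℝ, E') ∞ M]
  {i : M → X} {x : M} {p q r : ℕ}
  {g : SemiRiemannianMetric E X} {nabla : AffineConnection E X} {J : MetallicStructure g p q}
  {S : LightlikeSubmanifold E' g i r} {B : ∀ x : M, Submodule ℝ (TangentSpace 𝓘(ℝ, E) (i x))}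
  {U V : ∀ x : M, TangentSpace 𝓘(ℝ, E') x}

omit [FiniteDimensional ℝ E] [FiniteDimensional ℝ E'] [IsManifold 𝓘(ℝ, E) ∞ X] in
theorem IsSectionOf.mono {F F' : ∀ x : M, Submodule ℝ (TangentSpace 𝓘(ℝ, E) (i x))}
    (h : ∀ x, F x ≤ F' x) (hU : IsSectionOf i F U) : IsSectionOf i F' U :=
  ⟨hU.1, fun y => h y (hU.2 y)⟩

omit [FiniteDimensional ℝ E] [FiniteDimensional ℝ E'] [IsManifold 𝓘(ℝ, E) ∞ X] in
theorem IsSectionOf.mdifferentiableAt {F : ∀ x : M, Submodule ℝ (TangentSpace 𝓘(ℝ, E) (i x))}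
    (hU : IsSectionOf i F U) (x : M) :
    MDifferentiableAt 𝓘(ℝ, E') (𝓘(ℝ, E').prod 𝓘(ℝ, E'))
      (fun y => (TotalSpace.mk' E' y (U y) : TangentBundle 𝓘(ℝ, E') M)) x :=
  hU.1.contMDiffAt.mdifferentiableAt (by simp)

omit [FiniteDimensional ℝ E] [FiniteDimensional ℝ E'] [IsManifold 𝓘(ℝ, E') ∞ M] in
/-- Along `i`, the quarter symmetric connection differs from `∇` by the term `π(V) J(di(u))`. -/
theorem covAlong_quarterSymmetric (η : ∀ z : X, TangentSpace 𝓘(ℝ, E) z)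
    (V : ∀ x : M, TangentSpace 𝓘(ℝ, E) (i x)) (u : TangentSpace 𝓘(ℝ, E') x) :
    covAlong (quarterSymmetric g J nabla η) i V x u
      = covAlong nabla i V x u
        + g.val (i x) (η (i x)) (V x) • J.toFun (i x) (mfderiv 𝓘(ℝ, E') 𝓘(ℝ, E) i x u) := by
  have h : quarterSymmetric g J nabla η (FiberBundle.extend E (V x)) (i x)
      (mfderiv 𝓘(ℝ, E') 𝓘(ℝ, E) i x u)
      = nabla (FiberBundle.extend E (V x)) (i x) (mfderiv 𝓘(ℝ, E') 𝓘(ℝ, E) i x u)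
        + g.val (i x) (η (i x))
            ((FiberBundle.extend E (V x) : ∀ z : X, TangentSpace 𝓘(ℝ, E) z) (i x))
          • J.toFun (i x) (mfderiv 𝓘(ℝ, E') 𝓘(ℝ, E) i x u) := rfl
  rw [covAlong_eq, covAlong_eq, h, FiberBundle.extend_apply_self, add_assoc]

/-- For `J` parallel along `M`: `∇_U (J V) - ∇_V (J U) = J [U, V]`. -/
theorem covAlong_apply_sub (hn : IsLeviCivita g nabla) (hJ : IsParallelAlong (E' := E') J nabla i)
    (hi : ContMDiff 𝓘(ℝ, E') 𝓘(ℝ, E) ∞ i)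
    (hU : MDifferentiableAt 𝓘(ℝ, E') (𝓘(ℝ, E').prod 𝓘(ℝ, E'))
      (fun y => (TotalSpace.mk' E' y (U y) : TangentBundle 𝓘(ℝ, E') M)) x)
    (hV : MDifferentiableAt 𝓘(ℝ, E') (𝓘(ℝ, E').prod 𝓘(ℝ, E'))
      (fun y => (TotalSpace.mk' E' y (V y) : TangentBundle 𝓘(ℝ, E') M)) x) :
    covAlong nabla i (fun y => J.toFun (i y) (push i V y)) x (U x)
      - covAlong nabla i (fun y => J.toFun (i y) (push i U y)) x (V x)
      = J.toFun (i x) (push i (VectorField.mlieBracket 𝓘(ℝ, E') U V) x) := by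
  rw [hJ.covAlong_apply (mdiffAlongAt_push hi hV) (push_mem V),
    hJ.covAlong_apply (mdiffAlongAt_push hi hU) (push_mem U), ← map_sub,
    hn.torsion_along hi hU hV]

namespace LightlikeSubmanifold.IsScreenSemiInvariant

/-- For `U, V ∈ Γ(B)`, the `h^s`-condition at `x` says that `[U, V]` lies in `B ⊥ Rad(TM)` at `x`:
the difference of both sides is the `S(TM^⊥)`-component of `J [U, V]`. -/
theorem hs_eq_iff (hB : S.IsScreenSemiInvariant J B) (hq : 0 < q) (hn : IsLeviCivita g nabla)
    (hJ : IsParallelAlong (E' := E') J nabla i) (η : ∀ z : X, TangentSpace 𝓘(ℝ, E) z)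
    (hU : IsSectionOf i B U) (hV : IsSectionOf i B V) :
    S.hs (quarterSymmetric g J nabla η) U (fun y => J.toFun (i y) (push i V y)) x
        = S.hs (quarterSymmetric g J nabla η) V (fun y => J.toFun (i y) (push i U y)) x
      ↔ push i (VectorField.mlieBracket 𝓘(ℝ, E') U V) x ∈ B x ⊔ S.rad x := by
  have hπ : ∀ {W : ∀ x : M, TangentSpace 𝓘(ℝ, E') x}, IsSectionOf i B W →
      (S.screenTr x).projection _ (S.isCompl_screenTr x) (J.toFun (i x) (push i W x)) = 0 :=
    fun hW => S.projection_eq_zero (hB.B_le x (hB.apply_mem_B (hW.2 x)))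
  rw [← hB.projection_apply_eq_zero_iff hq (push_mem _), ← sub_eq_zero,
    ← covAlong_apply_sub hn hJ S.contMDiff (hU.mdifferentiableAt x) (hV.mdifferentiableAt x),
    hs, hs, covAlong_quarterSymmetric, covAlong_quarterSymmetric]
  have h1 := hπ hU
  have h2 := hπ hV
  rw [push] at h1 h2
  rw [map_add, map_add, map_smul, map_smul, h1, h2, smul_zero, smul_zero, add_zero, add_zero,
    map_sub]

variable [T2Space M]

/-- Each vector of `B ⊥ Rad(TM)` extends to a section of it. -/
theorem exists_isSectionOf_sup (hB : S.IsScreenSemiInvariant J B)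
    {v : TangentSpace 𝓘(ℝ, E) (i x)} (hv : v ∈ B x ⊔ S.rad x) :
    ∃ U : ∀ x : M, TangentSpace 𝓘(ℝ, E') x,
      IsSectionOf i (fun x => B x ⊔ S.rad x) U ∧ push i U x = v := by
  obtain ⟨b, hb, ρ, hρ, rfl⟩ := Submodule.mem_sup.1 hv
  obtain ⟨U, hU, rfl⟩ := exists_isSectionOf S.contMDiff S.immersion hB.smooth hB.B_le hb
  obtain ⟨V, hV, rfl⟩ := exists_isSectionOf S.contMDiff S.immersion S.rad_smooth S.rad_le hρ
  refine ⟨U + V, ⟨hU.1.add_section hV.1, fun y => ?_⟩, map_add _ _ _⟩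
  rw [Pi.add_apply, map_add]
  exact Submodule.add_mem_sup (hU.2 y) (hV.2 y)

omit [T2Space M] in
theorem exists_push_eq_apply (hB : S.IsScreenSemiInvariant J B)
    (hU : IsSectionOf i (fun x => B x ⊔ S.rad x) U) :
    ∃ U' : ∀ x : M, TangentSpace 𝓘(ℝ, E') x, IsSmoothField E' M U' ∧
      push i U' = fun y => J.toFun (i y) (push i U y) :=
  exists_lift S.immersion (fun _ => (smoothAlongAt_push S.contMDiff hU.1).apply J)
    fun y => hB.sup_le y (hB.apply_mem_sup (hU.2 y))

omit [T2Space M] in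
/-- For sections `U, V` of `B ⊥ Rad(TM)`, the second fundamental form in a normal direction `ν`
computes `g(J [U, V], ν)`. -/
theorem metric_apply_mlieBracket (hB : S.IsScreenSemiInvariant J B) (hn : IsLeviCivita g nabla)
    (hJ : IsParallelAlong (E' := E') J nabla i) (hU : IsSectionOf i (fun x => B x ⊔ S.rad x) U)
    (hV : IsSectionOf i (fun x => B x ⊔ S.rad x) V) {ν : TangentSpace 𝓘(ℝ, E) (i x)}
    (hν : ν ∈ g.orth (i x) (tangentImage (E' := E') i x)) {u v : TangentSpace 𝓘(ℝ, E') x}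
    (hu : mfderiv 𝓘(ℝ, E') 𝓘(ℝ, E) i x u = J.toFun (i x) (push i U x))
    (hv : mfderiv 𝓘(ℝ, E') 𝓘(ℝ, E) i x v = J.toFun (i x) (push i V x)) :
    g.val (i x) (J.toFun (i x) (push i (VectorField.mlieBracket 𝓘(ℝ, E') U V) x)) ν
      = secondForm g nabla i ν (U x) v - secondForm g nabla i ν (V x) u := by
  obtain ⟨U', hU', hUJ⟩ := hB.exists_push_eq_apply hU
  obtain ⟨V', hV', hVJ⟩ := hB.exists_push_eq_apply hV
  have eu : U' x = u := S.immersion x ((congrFun hUJ x).trans hu.symm)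
  have ev : V' x = v := S.immersion x ((congrFun hVJ x).trans hv.symm)
  rw [← covAlong_apply_sub hn hJ S.contMDiff (hU.mdifferentiableAt x) (hV.mdifferentiableAt x),
    ← hUJ, ← hVJ, map_sub, sub_apply,
    hn.metric_covAlong_push S.contMDiff hν (hU'.contMDiffAt.mdifferentiableAt (by simp)),
    hn.metric_covAlong_push S.contMDiff hν (hV'.contMDiffAt.mdifferentiableAt (by simp)), eu, ev]

/-- The second fundamental form is self-adjoint with respect to `J`, in the sense that
`h(a, J u, ν) = h(a, u, J ν)` for `u ∈ B ⊥ Rad(TM)`. -/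
theorem secondForm_apply (hB : S.IsScreenSemiInvariant J B) (hn : IsLeviCivita g nabla)
    (hJ : IsParallelAlong (E' := E') J nabla i) {ν : TangentSpace 𝓘(ℝ, E) (i x)}
    (hν : ν ∈ g.orth (i x) (tangentImage (E' := E') i x))
    (hJν : J.toFun (i x) ν ∈ g.orth (i x) (tangentImage (E' := E') i x))
    (a : TangentSpace 𝓘(ℝ, E') x) {u u' : TangentSpace 𝓘(ℝ, E') x}
    (hu : mfderiv 𝓘(ℝ, E') 𝓘(ℝ, E) i x u ∈ B x ⊔ S.rad x)
    (hu' : mfderiv 𝓘(ℝ, E') 𝓘(ℝ, E) i x u'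
      = J.toFun (i x) (mfderiv 𝓘(ℝ, E') 𝓘(ℝ, E) i x u)) :
    secondForm g nabla i ν a u' = secondForm g nabla i (J.toFun (i x) ν) a u := by
  obtain ⟨U, hU, hUx⟩ := hB.exists_isSectionOf_sup hu
  obtain ⟨U', hU', hUJ⟩ := hB.exists_push_eq_apply hU
  have e : U x = u := S.immersion x hUx
  have e' : U' x = u' := S.immersion x
    ((congrFun hUJ x).trans ((congrArg (J.toFun (i x)) hUx).trans hu'.symm))
  rw [← e, ← e', ← hn.metric_covAlong_push S.contMDiff hν
      (hU'.contMDiffAt.mdifferentiableAt (by simp)),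
    ← hn.metric_covAlong_push S.contMDiff hJν (hU.mdifferentiableAt x), hUJ,
    hJ.covAlong_apply (mdiffAlongAt_push S.contMDiff (hU.mdifferentiableAt x)) (push_mem U),
    J.compatible]

/-- For `w ∈ B^⊥` and `ξ ∈ Rad(TM)`, differentiating `g(J ξ, w) = 0` gives
`h(u, ξ, J w) = -h(u, w, J ξ)`. -/
theorem secondForm_rad (hB : S.IsScreenSemiInvariant J B) (hn : IsLeviCivita g nabla)
    (hJ : IsParallelAlong (E' := E') J nabla i) {w ξ : TangentSpace 𝓘(ℝ, E') x}
    (hw : mfderiv 𝓘(ℝ, E') 𝓘(ℝ, E) i x w ∈ S.perpInScreen B x)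
    (hξ : mfderiv 𝓘(ℝ, E') 𝓘(ℝ, E) i x ξ ∈ S.rad x) (u : TangentSpace 𝓘(ℝ, E') x) :
    secondForm g nabla i (J.toFun (i x) (mfderiv 𝓘(ℝ, E') 𝓘(ℝ, E) i x w)) u ξ
      = -secondForm g nabla i (J.toFun (i x) (mfderiv 𝓘(ℝ, E') 𝓘(ℝ, E) i x ξ)) u w := by
  obtain ⟨U, hU, hUx⟩ := exists_isSectionOf S.contMDiff S.immersion S.rad_smooth S.rad_le hξ
  have e : U x = ξ := S.immersion x hUx
  have hUd := mdiffAlongAt_push S.contMDiff (hU.mdifferentiableAt x)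
  let W : ∀ x : M, TangentSpace 𝓘(ℝ, E') x := FiberBundle.extend E' w
  have hW : MDiffAlongAt E' i (push (E := E) i W) x :=
    mdiffAlongAt_push S.contMDiff (FiberBundle.mdifferentiableAt_extend 𝓘(ℝ, E') E' w)
  have hWx : push (E := E) i W x = mfderiv 𝓘(ℝ, E') 𝓘(ℝ, E) i x w := by
    simp only [push, W, FiberBundle.extend_apply_self]
  have h0 : (fun y => g.val (i y) (J.toFun (i y) (push i U y)) (push i W y)) = fun _ => 0 := by
    ext y
    rw [g.symm]
    exact S.rad_le_orth y (hB.apply_mem_rad (hU.2 y)) _ (push_mem W)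
  have h := hn.metric_along (hUd.apply J) hW u
  rw [h0, mvfderiv_eq_zero_of_eventuallyEq_const (c := (0 : ℝ)) .rfl,
    hJ.covAlong_apply hUd (push_mem U), ← J.compatible, hWx,
    hn.metric_covAlong_push S.contMDiff
      (S.screenTr_le_orth x (hB.apply_mem_screenTr hw)) (hU.mdifferentiableAt x), e, hUx,
    g.symm] at h
  exact eq_neg_of_add_eq_zero_left h.symm

/-- For `w ∈ B^⊥`, `u ∈ B ⊥ Rad(TM)` and `ξ ∈ Rad(TM)`: `h(u, J ξ, J w) = h(ξ, J u, J w)`. Both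
sides equal `-h(u, w, J² ξ)`. -/
theorem secondForm_apply_rad (hB : S.IsScreenSemiInvariant J B) (hn : IsLeviCivita g nabla)
    (hJ : IsParallelAlong (E' := E') J nabla i) {w ξ ξ' u u' : TangentSpace 𝓘(ℝ, E') x}
    (hw : mfderiv 𝓘(ℝ, E') 𝓘(ℝ, E) i x w ∈ S.perpInScreen B x)
    (hξ : mfderiv 𝓘(ℝ, E') 𝓘(ℝ, E) i x ξ ∈ S.rad x)
    (hξ' : mfderiv 𝓘(ℝ, E') 𝓘(ℝ, E) i x ξ' = J.toFun (i x) (mfderiv 𝓘(ℝ, E') 𝓘(ℝ, E) i x ξ))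
    (hu : mfderiv 𝓘(ℝ, E') 𝓘(ℝ, E) i x u ∈ B x ⊔ S.rad x)
    (hu' : mfderiv 𝓘(ℝ, E') 𝓘(ℝ, E) i x u' = J.toFun (i x) (mfderiv 𝓘(ℝ, E') 𝓘(ℝ, E) i x u)) :
    secondForm g nabla i (J.toFun (i x) (mfderiv 𝓘(ℝ, E') 𝓘(ℝ, E) i x w)) u ξ'
      = secondForm g nabla i (J.toFun (i x) (mfderiv 𝓘(ℝ, E') 𝓘(ℝ, E) i x w)) ξ u' := by
  have hJξ := hB.apply_mem_rad hξ
  have hJJξ := hB.apply_mem_rad hJξ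
  rw [hB.secondForm_rad hn hJ hw (hξ' ▸ hJξ), hξ',
    hn.secondForm_symm S.contMDiff (S.screenTr_le_orth x (hB.apply_mem_screenTr hw)) ξ u',
    hB.secondForm_rad hn hJ hw hξ, hn.secondForm_symm S.contMDiff (S.rad_le_orth x hJξ),
    hB.secondForm_apply hn hJ (S.rad_le_orth x hJξ) (S.rad_le_orth x hJJξ) w hu hu',
    hn.secondForm_symm S.contMDiff (S.rad_le_orth x hJJξ)]

/-- If, at the point `x`, brackets of sections of `B` lie in `B ⊥ Rad(TM)`, then so do brackets of
sections of `B ⊥ Rad(TM)`. -/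
theorem push_mlieBracket_mem (hB : S.IsScreenSemiInvariant J B) (hq : 0 < q)
    (hn : IsLeviCivita g nabla) (hJ : IsParallelAlong (E' := E') J nabla i)
    (h : ∀ U V : ∀ x : M, TangentSpace 𝓘(ℝ, E') x, IsSectionOf i B U → IsSectionOf i B V →
      push i (VectorField.mlieBracket 𝓘(ℝ, E') U V) x ∈ B x ⊔ S.rad x)
    (hU : IsSectionOf i (fun x => B x ⊔ S.rad x) U)
    (hV : IsSectionOf i (fun x => B x ⊔ S.rad x) V) :
    push i (VectorField.mlieBracket 𝓘(ℝ, E') U V) x ∈ B x ⊔ S.rad x := by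
  refine hB.mem_sup_of_metric_apply hq (push_mem _) fun w₀ hw₀ => ?_
  obtain ⟨w, rfl⟩ := S.screen_le x hw₀.1
  have hw : mfderiv 𝓘(ℝ, E') 𝓘(ℝ, E) i x w ∈ S.perpInScreen B x := hw₀
  have hν := S.screenTr_le_orth x (hB.apply_mem_screenTr hw)
  have hlift : ∀ v ∈ B x ⊔ S.rad x, ∃ u, mfderiv 𝓘(ℝ, E') 𝓘(ℝ, E) i x u = v :=
    fun v hv => hB.sup_le x hv
  -- the components of a section in `B` and `Rad(TM)`, and the images of these under `J`, as
  -- vectors of `T_x M`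
  have key : ∀ {W : ∀ x : M, TangentSpace 𝓘(ℝ, E') x}, IsSectionOf i (fun x => B x ⊔ S.rad x) W →
      ∃ b b' ξ ξ', mfderiv 𝓘(ℝ, E') 𝓘(ℝ, E) i x b ∈ B x ∧
        mfderiv 𝓘(ℝ, E') 𝓘(ℝ, E) i x b' = J.toFun (i x) (mfderiv 𝓘(ℝ, E') 𝓘(ℝ, E) i x b) ∧
        mfderiv 𝓘(ℝ, E') 𝓘(ℝ, E) i x ξ ∈ S.rad x ∧
        mfderiv 𝓘(ℝ, E') 𝓘(ℝ, E) i x ξ' = J.toFun (i x) (mfderiv 𝓘(ℝ, E') 𝓘(ℝ, E) i x ξ) ∧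
        W x = b + ξ := by
    intro W hW
    obtain ⟨b₀, hb, ξ₀, hξ, hbξ⟩ := Submodule.mem_sup.1 (hW.2 x)
    obtain ⟨b, rfl⟩ := hlift _ (Submodule.mem_sup_left hb)
    obtain ⟨ξ, rfl⟩ := hlift _ (Submodule.mem_sup_right hξ)
    obtain ⟨b', hb'⟩ := hlift _ (Submodule.mem_sup_left (hB.apply_mem_B hb))
    obtain ⟨ξ', hξ'⟩ := hlift _ (Submodule.mem_sup_right (hB.apply_mem_rad hξ))
    refine ⟨b, b', ξ, ξ', hb, hb', hξ, hξ', S.immersion x ?_⟩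
    rw [map_add, hbξ]
  obtain ⟨a, a', α, α', ha, ha', hα, hα', hUx⟩ := key hU
  obtain ⟨b, b', β, β', hb, hb', hβ, hβ', hVx⟩ := key hV
  have hU' : mfderiv 𝓘(ℝ, E') 𝓘(ℝ, E) i x (a' + α') = J.toFun (i x) (push i U x) := by
    rw [push, hUx, map_add, map_add, map_add, ha', hα']
  have hV' : mfderiv 𝓘(ℝ, E') 𝓘(ℝ, E) i x (b' + β') = J.toFun (i x) (push i V x) := by
    rw [push, hVx, map_add, map_add, map_add, hb', hβ']
  -- the terms of `h(U, J V, J w) - h(V, J U, J w)` with one argument in `Rad(TM)` cancel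
  have e1 := hB.secondForm_apply_rad hn hJ hw hβ hβ' (hU.2 x) hU'
  have e2 := hB.secondForm_apply_rad hn hJ hw hα hα' (Submodule.mem_sup_left hb) hb'
  -- the remaining terms cancel since the bracket of sections of `B` lies in `B ⊥ Rad(TM)`
  obtain ⟨U₁, hU₁, hU₁x⟩ := exists_isSectionOf S.contMDiff S.immersion hB.smooth hB.B_le ha
  obtain ⟨V₁, hV₁, hV₁x⟩ := exists_isSectionOf S.contMDiff S.immersion hB.smooth hB.B_le hb
  have eU : U₁ x = a := S.immersion x hU₁x
  have eV : V₁ x = b := S.immersion x hV₁x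
  have e3 := hB.metric_apply_mlieBracket hn hJ (hU₁.mono fun _ => le_sup_left)
    (hV₁.mono fun _ => le_sup_left) hν (u := a') (v := b') (by rw [hU₁x, ha']) (by rw [hV₁x, hb'])
  rw [hB.metric_apply_eq_zero (h U₁ V₁ hU₁ hV₁) hw, eU, eV] at e3
  have e4 := hB.metric_apply_mlieBracket hn hJ hU hV hν hU' hV'
  refine e4.trans ?_
  rw [hn.secondForm_add_right S.contMDiff hν (U x) b' β', e1, hUx, hVx, secondForm_add_left,
    secondForm_add_left, hn.secondForm_add_right S.contMDiff hν b, e2]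
  linarith

end LightlikeSubmanifold.IsScreenSemiInvariant

end Bracket

end LightlikeGeometry
end

open LightlikeGeometry in
theorem mainTheorem7
    {E : Type*} [NormedAddCommGroup E] [NormedSpace ℝ E] [FiniteDimensional ℝ E]
    {X : Type*} [TopologicalSpace X] [T2Space X] [SecondCountableTopology X]
    [ChartedSpace E X] [IsManifold 𝓘(ℝ, E) ∞ X]
    {E' : Type*} [NormedAddCommGroup E'] [NormedSpace ℝ E'] [FiniteDimensional ℝ E']
    {M : Type*} [TopologicalSpace M] [T2Space M] [SecondCountableTopology M]
    [ChartedSpace E' M] [IsManifold 𝓘(ℝ, E') ∞ M]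
    (g : SemiRiemannianMetric E X) (p q : ℕ) (hp : 0 < p) (hq : 0 < q)
    (J : MetallicStructure g p q)
    (nabla : AffineConnection E X) (hnabla : IsLeviCivita g nabla)
    (η : ∀ z : X, TangentSpace 𝓘(ℝ, E) z) (hη : IsSmoothField E X η)
    (i : M → X) (r : ℕ) (S : LightlikeSubmanifold E' g i r)
    (hJ : IsParallelAlong (E' := E') J nabla i)
    (B : ∀ x : M, Submodule ℝ (TangentSpace 𝓘(ℝ, E) (i x)))
    (hB : S.IsScreenSemiInvariant J B) :
    IsIntegrable E' i (fun x => B x ⊔ S.rad x) ↔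
      ∀ U V : ∀ x : M, TangentSpace 𝓘(ℝ, E') x, IsSectionOf i B U → IsSectionOf i B V →
        ∀ x : M,
          S.hs (quarterSymmetric g J nabla η) U
              (fun y => J.toFun (i y) (mfderiv 𝓘(ℝ, E') 𝓘(ℝ, E) i y (V y))) x
            = S.hs (quarterSymmetric g J nabla η) V
              (fun y => J.toFun (i y) (mfderiv 𝓘(ℝ, E') 𝓘(ℝ, E) i y (U y))) x := by
  constructor
  · intro h U V hU hV x
    exact (hB.hs_eq_iff hq hnabla hJ η hU hV).2
      ((h U V (hU.mono fun _ => le_sup_left) (hV.mono fun _ => le_sup_left)).2 x)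
  · intro h U V hU hV
    refine ⟨?_, fun x => hB.push_mlieBracket_mem hq hnabla hJ
      (fun U V hU hV => (hB.hs_eq_iff hq hnabla hJ η hU hV).1 (h U V hU hV x)) hU hV⟩
    have : CompleteSpace E' := FiniteDimensional.complete ℝ E'
    have : IsManifold 𝓘(ℝ, E') (minSmoothness ℝ 2) M := by
      rw [minSmoothness_of_isRCLikeNormedField]
      exact IsManifold.of_le (n := ∞) ENat.LEInfty.out
    have : IsManifold 𝓘(ℝ, E') (((⊤ : ℕ∞) : ℕ∞ω) + 1) M :=
      inferInstanceAs (IsManifold 𝓘(ℝ, E') ∞ M)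
    exact ContDiff.mlieBracket_vectorField (m := ⊤) (n := ⊤) hU.1 hV.1 (by simp)
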